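/- Let $n,d\ge 1$ be integers, $a<b$ real, and $B,C\in\mathbb{R}^{nd\times nd}$ with $n\times n$ blocks $B_{i,j},C_{i,j}$ ($1\le i,j\le d$). Let $L_2^n=L_2^n[a,b]$ be the real Hilbert space of square-integrable functions $[a,b]\to\mathbb{R}^n$, let $W_2^{d,n}[a,b]\subseteq L_2^n$ be the subspace of functions whose weak derivatives $\partial_s^k\mathbf u$, $k\le d$, all lie in $L_2^n$, and put $$D:=\Big\{\mathbf u\in W_2^{d,n}[a,b]\ \Big|\ \sum_{j=1}^{d}\big(B_{i,j}\,\partial_s^{j-1}\mathbf u(a)+C_{i,j}\,\partial_s^{j-1}\mathbf u(b)\big)=0,\ \ i=1,\dots,d\Big\},$$ where boundary values are those of the continuous representatives. Let $\mathbf Q(z)\in\mathbb{R}^{nd\times nd}$ be the block matrix whose $(i,j)$ block is $\frac{z^{j-i}}{(j-i)!}I_n$ for $i\le j$ and $0$ for $i>j$, and assume that $D$ is PIE compatible, i.e. that $K:=B+C\,\mathbf Q(b-a)$ is invertible. Let $E_1,E_d\in\mathbb{R}^{nd\times n}$ be the block columns with $I_n$ in the first, respectively last, block and $0$ elsewhere,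 and let $\mathcal T=(\partial_s^d)^{-1}:L_2^n\to D$ be given by $(\mathcal T\mathbf v)(s)=\int_a^b\mathbf G(s,\theta)\mathbf v(\theta)\,d\theta$ with $$\mathbf G(s,\theta)=\begin{cases}E_1^T\big(\mathbf Q(s-\theta)-\mathbf Q(s-a)K^{-1}C\,\mathbf Q(b-\theta)\big)E_d,&\theta\le s,\\ -E_1^T\mathbf Q(s-a)K^{-1}C\,\mathbf Q(b-\theta)E_d,&\theta>s.\end{cases}$$ For matrix polynomials $\mathbf A_0,\dots,\mathbf A_d\in\mathbb{R}^{n\times n}[s]$ define $A:D\to L_2^n$ by $(A\mathbf u)(s)=\sum_{k=0}^d\mathbf A_k(s)\,\partial_s^k\mathbf u(s)$, and let $\mathcal A:=A\circ\mathcal T$, a bounded operator on $L_2^n$. A PI operator is a bounded operator on $L_2^n$ of the form $$(\mathcal P\mathbf v)(s)=\mathbf P_0(s)\mathbf v(s)+\int_a^s\mathbf P_1(s,\theta)\mathbf v(\theta)\,d\theta+\int_s^b\mathbf P_2(s,\theta)\mathbf v(\theta)\,d\theta$$ with matrix-valued polynomials $\mathbf P_0,\mathbf P_1,\mathbf P_2$.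 For bounded operators, $X\succeq Y$ means that $X-Y$ is self-adjoint and positive semidefinite. Let $\epsilon_1,\epsilon_2>0$ and $\omega\in\mathbb{R}$. If a PI operator $\mathcal P$ and a scalar $\lambda>\omega$ satisfy $$\mathcal P\succeq\epsilon_1^2I,\qquad \mathcal T^*\mathcal P\mathcal A+\mathcal A^*\mathcal P\mathcal T\preceq 2\omega\,\mathcal T^*\mathcal P\mathcal T,\qquad (\lambda\mathcal T-\mathcal A)(\lambda\mathcal T^*-\mathcal A^*)\succeq\epsilon_2^2I,$$ then $A$, with domain $D$, is the infinitesimal generator of a $C_0$-semigroup $(S(t))_{t\ge0}$ on $L_2^n$ with growth rate $\omega$ and gain $M:=\sqrt{\|\mathcal P\|}/\epsilon_1$; that is, $M\ge1$ and $\|S(t)\|\le Me^{\omega t}$ for all $t\ge0$. -/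

import Mathlib

open MeasureTheory Filter Topology
open scoped Polynomial ContDiff NNReal

noncomputable section

namespace PIE

/-- `ℝⁿ` with the Euclidean norm. -/
abbrev Vec (n : ℕ) := EuclideanSpace ℝ (Fin n)

/-- The real Hilbert space `L₂ⁿ[a,b]`. -/
abbrev L2 (n : ℕ) (a b : ℝ) := Lp (Vec n) 2 (volume.restrict (Set.Icc a b))

/-- A real matrix acting on `ℝⁿ`. -/
abbrev matCLM {n : ℕ} (M : Matrix (Fin n) (Fin n) ℝ) : Vec n →L[ℝ] Vec n :=
  Matrix.toEuclideanCLM (n := Fin n) (𝕜 := ℝ) M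

/-- `w` is the `k`-th weak derivative of `u` on `(a,b)`. -/
def HasWeakDeriv {n : ℕ} (a b : ℝ) (k : ℕ) (u w : ℝ → Vec n) : Prop :=
  ∀ φ : ℝ → ℝ, ContDiff ℝ ∞ φ → HasCompactSupport φ → tsupport φ ⊆ Set.Ioo a b →
    ∫ s in Set.Icc a b, iteratedDeriv k φ s • u s
      = (-1 : ℝ) ^ k • ∫ s in Set.Icc a b, φ s • w s

theorem L2.integrable {n : ℕ} {a b : ℝ} (u : L2 n a b) :
    Integrable u (volume.restrict (Set.Icc a b)) :=
  (Lp.memLp u).integrable (by norm_num)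

theorem L2.integrable_smul {n : ℕ} {a b : ℝ} (u : L2 n a b) {φ : ℝ → ℝ} (hφ : Continuous φ) :
    Integrable (fun s => φ s • u s) (volume.restrict (Set.Icc a b)) := by
  have : IntegrableOn (fun s => φ s • u s) (Set.Icc a b) :=
    IntegrableOn.continuousOn_smul (L2.integrable u) hφ.continuousOn isCompact_Icc
  exact this

theorem HasWeakDeriv.unique {n : ℕ} {a b : ℝ} {k : ℕ} {u : ℝ → Vec n} {w w' : L2 n a b}
    (h : HasWeakDeriv a b k u w) (h' : HasWeakDeriv a b k u w') : w = w' := by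
  rw [← sub_eq_zero]
  refine (Lp.eq_zero_iff_ae_eq_zero).2 ?_
  have key := isOpen_Ioo.ae_eq_zero_of_integral_contDiff_smul_eq_zero (U := Set.Ioo a b)
    (f := (w - w' : L2 n a b)) (μ := volume.restrict (Set.Icc a b))
    ((L2.integrable (w - w')).locallyIntegrable.locallyIntegrableOn _) (fun g hg hc hs => ?_)
  · have h1 : ∀ᵐ x ∂(volume.restrict (Set.Icc a b)), x ∈ Set.Ioo a b := by
      rw [← restrict_Ioo_eq_restrict_Icc]
      exact ae_restrict_mem measurableSet_Ioo
    filter_upwards [key, h1] with x hx hx1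
    exact hx hx1
  · have e : ∫ s in Set.Icc a b, g s • (w - w' : L2 n a b) s
        = (∫ s in Set.Icc a b, g s • w s) - ∫ s in Set.Icc a b, g s • w' s := by
      rw [← integral_sub (L2.integrable_smul w hg.continuous) (L2.integrable_smul w' hg.continuous)]
      apply integral_congr_ae
      filter_upwards [Lp.coeFn_sub w w'] with s hs
      rw [hs, Pi.sub_apply, smul_sub]
    rw [e, sub_eq_zero]
    have h2 := (h g hg hc hs).symm.trans (h' g hg hc hs)
    exact smul_right_injective _ (pow_ne_zero k (by norm_num : (-1 : ℝ) ≠ 0)) h2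

theorem continuous_iteratedDeriv_test {φ : ℝ → ℝ} (hφ : ContDiff ℝ ∞ φ) (k : ℕ) :
    Continuous (iteratedDeriv k φ) :=
  hφ.continuous_iteratedDeriv k (by exact_mod_cast le_top)

theorem HasWeakDeriv.add {n : ℕ} {a b : ℝ} {k : ℕ} {u u' w w' : L2 n a b}
    (h : HasWeakDeriv a b k u w) (h' : HasWeakDeriv a b k u' w') :
    HasWeakDeriv a b k (u + u' : L2 n a b) (w + w' : L2 n a b) := by
  intro φ hφ hc hs
  have e : ∀ (ψ : ℝ → ℝ), Continuous ψ → ∀ f g : L2 n a b,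
      ∫ s in Set.Icc a b, ψ s • (f + g : L2 n a b) s
        = (∫ s in Set.Icc a b, ψ s • f s) + ∫ s in Set.Icc a b, ψ s • g s := by
    intro ψ hψ f g
    rw [← integral_add (L2.integrable_smul f hψ) (L2.integrable_smul g hψ)]
    apply integral_congr_ae
    filter_upwards [Lp.coeFn_add f g] with s hs
    rw [hs, Pi.add_apply, smul_add]
  rw [e _ (continuous_iteratedDeriv_test hφ k), e _ hφ.continuous, h φ hφ hc hs, h' φ hφ hc hs,
    smul_add]

theorem HasWeakDeriv.const_smul {n : ℕ} {a b : ℝ} {k : ℕ} {u w : L2 n a b} (c : ℝ)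
    (h : HasWeakDeriv a b k u w) :
    HasWeakDeriv a b k (c • u : L2 n a b) (c • w : L2 n a b) := by
  intro φ hφ hc hs
  have e : ∀ (ψ : ℝ → ℝ) (f : L2 n a b),
      ∫ s in Set.Icc a b, ψ s • (c • f : L2 n a b) s
        = c • ∫ s in Set.Icc a b, ψ s • f s := by
    intro ψ f
    rw [← integral_smul]
    apply integral_congr_ae
    filter_upwards [Lp.coeFn_smul c f] with s hs
    rw [hs, Pi.smul_apply, smul_comm]
  rw [e, e, h φ hφ hc hs, smul_comm]

theorem HasWeakDeriv.zero {n : ℕ} {a b : ℝ} {k : ℕ} :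
    HasWeakDeriv a b k (0 : L2 n a b) (0 : L2 n a b) := by
  intro φ hφ hc hs
  have e : ∀ (ψ : ℝ → ℝ), ∫ s in Set.Icc a b, ψ s • (0 : L2 n a b) s = 0 := by
    intro ψ
    rw [← integral_zero (α := ℝ) (μ := volume.restrict (Set.Icc a b)) (G := Vec n)]
    apply integral_congr_ae
    filter_upwards [Lp.coeFn_zero (Vec n) 2 (volume.restrict (Set.Icc a b))] with s hs
    rw [hs, Pi.zero_apply, smul_zero]
  rw [e, e, smul_zero]

/-- The Sobolev space `W₂^{d,n}[a,b]`: all weak derivatives of order `≤ d` lie in `L₂ⁿ`. -/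
def sobolev (n d : ℕ) (a b : ℝ) : Submodule ℝ (L2 n a b) where
  carrier := {u | ∀ k : Fin (d + 1), ∃ w : L2 n a b, HasWeakDeriv a b k u w}
  add_mem' := fun hu hu' k => by
    obtain ⟨w, hw⟩ := hu k
    obtain ⟨w', hw'⟩ := hu' k
    exact ⟨w + w', hw.add hw'⟩
  zero_mem' := fun _ => ⟨0, HasWeakDeriv.zero⟩
  smul_mem' := fun c _ hu k => by
    obtain ⟨w, hw⟩ := hu k
    exact ⟨c • w, hw.const_smul c⟩

theorem weakDeriv_spec {n d : ℕ} {a b : ℝ} (k : Fin (d + 1)) (u : sobolev n d a b) :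
    HasWeakDeriv a b k (u : L2 n a b) (u.2 k).choose :=
  (u.2 k).choose_spec

/-- The weak derivative `∂_s^k` as a linear map on `W₂^{d,n}[a,b]`, `0 ≤ k ≤ d`. -/
def weakDeriv {n d : ℕ} {a b : ℝ} (k : Fin (d + 1)) : sobolev n d a b →ₗ[ℝ] L2 n a b where
  toFun u := (u.2 k).choose
  map_add' u v := (weakDeriv_spec k (u + v)).unique ((weakDeriv_spec k u).add (weakDeriv_spec k v))
  map_smul' c u := (weakDeriv_spec k (c • u)).unique ((weakDeriv_spec k u).const_smul c)

theorem integral_norm_le {n : ℕ} (a b : ℝ) :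
    ∃ K : ℝ, 0 ≤ K ∧ ∀ u : L2 n a b, ∫ s in Set.Icc a b, ‖u s‖ ≤ K * ‖u‖ := by
  set μ := volume.restrict (Set.Icc a b) with hμ
  refine ⟨(μ Set.univ ^ (1 / (1 : ENNReal).toReal - 1 / (2 : ENNReal).toReal)).toReal,
    ENNReal.toReal_nonneg, fun u => ?_⟩
  have h := eLpNorm_le_eLpNorm_mul_rpow_measure_univ (p := 1) (q := 2) (μ := μ) (f := u)
    (by norm_num) (Lp.aestronglyMeasurable u)
  rw [integral_norm_eq_lintegral_enorm (Lp.aestronglyMeasurable u), ← eLpNorm_one_eq_lintegral_enorm,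
    Lp.norm_def, mul_comm, ← ENNReal.toReal_mul]
  refine ENNReal.toReal_mono ?_ h
  refine ENNReal.mul_ne_top (Lp.eLpNorm_ne_top u) ?_
  exact ENNReal.rpow_ne_top_of_nonneg (by norm_num) (measure_ne_top _ _)

theorem continuous_integral_smul {n : ℕ} {a b : ℝ} {ψ : ℝ → ℝ} (hψ : Continuous ψ) :
    Continuous (fun u : L2 n a b => ∫ s in Set.Icc a b, ψ s • u s) := by
  obtain ⟨M, hM⟩ := (isCompact_Icc (a := a) (b := b)).exists_bound_of_continuousOn hψ.continuousOn
  have hm : ∀ᵐ s ∂(volume.restrict (Set.Icc a b)), s ∈ Set.Icc a b :=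
    ae_restrict_mem measurableSet_Icc
  obtain ⟨K, hK0, hK⟩ := integral_norm_le (n := n) a b
  let Λ : L2 n a b →ₗ[ℝ] Vec n :=
    { toFun := fun u => ∫ s in Set.Icc a b, ψ s • u s
      map_add' := fun f g => by
        rw [← integral_add (L2.integrable_smul f hψ) (L2.integrable_smul g hψ)]
        apply integral_congr_ae
        filter_upwards [Lp.coeFn_add f g] with s hs
        rw [hs, Pi.add_apply, smul_add]
      map_smul' := fun c f => by
        rw [RingHom.id_apply, ← integral_smul]
        apply integral_congr_ae
        filter_upwards [Lp.coeFn_smul c f] with s hs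
        rw [hs, Pi.smul_apply, smul_comm] }
  refine (Λ.mkContinuous (max M 0 * K) fun u => ?_).continuous
  calc ‖∫ s in Set.Icc a b, ψ s • u s‖ ≤ ∫ s in Set.Icc a b, max M 0 * ‖u s‖ := by
        refine norm_integral_le_of_norm_le ((L2.integrable u).norm.const_mul _) ?_
        filter_upwards [hm] with s hs
        rw [norm_smul]
        gcongr
        exact (hM s hs).trans (le_max_left _ _)
    _ = max M 0 * ∫ s in Set.Icc a b, ‖u s‖ := integral_const_mul _ _
    _ ≤ max M 0 * (K * ‖u‖) := by gcongr; exact hK u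
    _ = max M 0 * K * ‖u‖ := by ring

theorem HasWeakDeriv.of_tendsto {n : ℕ} {a b : ℝ} {k : ℕ} {u w : ℕ → L2 n a b} {u' w' : L2 n a b}
    (h : ∀ m, HasWeakDeriv a b k (u m) (w m)) (hu : Tendsto u atTop (𝓝 u'))
    (hw : Tendsto w atTop (𝓝 w')) : HasWeakDeriv a b k u' w' := by
  intro φ hφ hc hs
  have h1 := ((continuous_integral_smul (n := n) (a := a) (b := b)
    (continuous_iteratedDeriv_test hφ k)).tendsto u').comp hu
  have h2 := (((continuous_integral_smul (n := n) (a := a) (b := b)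
    hφ.continuous).tendsto w').comp hw).const_smul ((-1 : ℝ) ^ k)
  refine tendsto_nhds_unique h1 (h2.congr fun m => ?_)
  exact (h m φ hφ hc hs).symm

theorem continuous_toCLM {n : ℕ} : Continuous fun M : Matrix (Fin n) (Fin n) ℝ => matCLM M :=
  LinearMap.continuous_of_finiteDimensional
    ({ toFun := fun M => matCLM M
       map_add' := fun _ _ => map_add _ _ _
       map_smul' := fun _ _ => map_smul _ _ _ } :
      Matrix (Fin n) (Fin n) ℝ →ₗ[ℝ] (Vec n →L[ℝ] Vec n))

theorem aesm_clm_apply {α : Type*} [MeasurableSpace α] {μ : Measure α} {n : ℕ}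
    {f : α → Vec n →L[ℝ] Vec n} {g : α → Vec n} (hf : AEStronglyMeasurable f μ)
    (hg : AEStronglyMeasurable g μ) : AEStronglyMeasurable (fun x => f x (g x)) μ :=
  (ContinuousLinearMap.id ℝ (Vec n →L[ℝ] Vec n)).aestronglyMeasurable_comp₂ hf hg

theorem memLp_clm {n : ℕ} {a b : ℝ} {M : ℝ → Matrix (Fin n) (Fin n) ℝ} (hM : Continuous M)
    (u : L2 n a b) :
    MemLp (fun s => matCLM (M s) (u s)) 2 (volume.restrict (Set.Icc a b)) := by
  have hc : Continuous fun s => matCLM (M s) :=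
    continuous_toCLM.comp hM
  obtain ⟨c, hcb⟩ := (isCompact_Icc (a := a) (b := b)).exists_bound_of_continuousOn hc.continuousOn
  refine MemLp.of_le_mul (c := c) (Lp.memLp u) ?_ ?_
  · exact aesm_clm_apply hc.aestronglyMeasurable (Lp.aestronglyMeasurable u)
  · filter_upwards [ae_restrict_mem measurableSet_Icc] with s hs
    exact (ContinuousLinearMap.le_opNorm _ _).trans (by gcongr; exact hcb s hs)

theorem continuous_evalMatrix {n : ℕ} (M : Matrix (Fin n) (Fin n) ℝ[X]) :
    Continuous fun s : ℝ => M.map (Polynomial.eval s) := by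
  refine continuous_matrix fun i j => ?_
  exact (M i j).continuous

/-- Multiplication by a matrix-valued polynomial: `(M_A v)(s) = A(s) v(s)`. -/
def mulOp {n : ℕ} {a b : ℝ} (M : Matrix (Fin n) (Fin n) ℝ[X]) : L2 n a b →L[ℝ] L2 n a b :=
  LinearMap.mkContinuousOfExistsBound
    { toFun := fun u => (memLp_clm (continuous_evalMatrix M) u).toLp
      map_add' := fun u v => by
        apply Lp.ext
        refine (MemLp.coeFn_toLp _).trans (EventuallyEq.trans ?_ (Lp.coeFn_add _ _).symm)
        filter_upwards [Lp.coeFn_add u v, (memLp_clm (continuous_evalMatrix M) u).coeFn_toLp,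
          (memLp_clm (continuous_evalMatrix M) v).coeFn_toLp] with s h1 h2 h3
        rw [h1, Pi.add_apply, Pi.add_apply, h2, h3, map_add]
      map_smul' := fun c u => by
        apply Lp.ext
        refine (MemLp.coeFn_toLp _).trans (EventuallyEq.trans ?_ (Lp.coeFn_smul _ _).symm)
        filter_upwards [Lp.coeFn_smul c u,
          (memLp_clm (continuous_evalMatrix M) u).coeFn_toLp] with s h1 h2
        rw [h1, Pi.smul_apply, Pi.smul_apply, h2, map_smul, RingHom.id_apply] }
    (by
      have hc : Continuous fun s : ℝ => matCLM (M.map (Polynomial.eval s)) :=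
        continuous_toCLM.comp (continuous_evalMatrix M)
      obtain ⟨c, hcb⟩ :=
        (isCompact_Icc (a := a) (b := b)).exists_bound_of_continuousOn hc.continuousOn
      refine ⟨c, fun u => Lp.norm_le_mul_norm_of_ae_le_mul ?_⟩
      filter_upwards [(memLp_clm (continuous_evalMatrix M) u).coeFn_toLp,
        ae_restrict_mem measurableSet_Icc] with s h1 hs
      refine (congrArg norm h1).trans_le ?_
      exact (ContinuousLinearMap.le_opNorm _ _).trans (by gcongr; exact hcb s hs))

/-- The `nd × nd` block upper triangular matrix `Q(z)` whose `(i,j)` block is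
`z^(j-i)/(j-i)! • I_n` for `i ≤ j` and zero otherwise. An index is a pair
(block index, index inside the block). -/
def matQ (n d : ℕ) (z : ℝ) : Matrix (Fin d × Fin n) (Fin d × Fin n) ℝ :=
  Matrix.of fun p q =>
    if p.1 ≤ q.1 ∧ p.2 = q.2 then z ^ (q.1.val - p.1.val) / (q.1.val - p.1.val).factorial else 0

/-- `K = B + C Q(b-a)`. -/
def matK {n d : ℕ} (a b : ℝ) (B C : Matrix (Fin d × Fin n) (Fin d × Fin n) ℝ) :
    Matrix (Fin d × Fin n) (Fin d × Fin n) ℝ :=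
  B + C * matQ n d (b - a)

/-- The `n × n` block `B_{i,j}`. -/
def block {n d : ℕ} (B : Matrix (Fin d × Fin n) (Fin d × Fin n) ℝ) (i j : Fin d) :
    Matrix (Fin n) (Fin n) ℝ :=
  Matrix.of fun p q => B (i, p) (j, q)

/-- The boundary conditions are PIE compatible: `K` is invertible. -/
def PIECompatible {n d : ℕ} (a b : ℝ) (B C : Matrix (Fin d × Fin n) (Fin d × Fin n) ℝ) : Prop :=
  IsUnit (matK a b B C)

/-- The `nd × n` matrix whose block with (zero-based) number `k` is `I_n` and whose other blocks
vanish; `blockCol n d 0` is `E₁` and `blockCol n d (d - 1)` is `E_d`. -/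
def blockCol (n d k : ℕ) : Matrix (Fin d × Fin n) (Fin n) ℝ :=
  Matrix.of fun p q => if p.1.val = k ∧ p.2 = q then 1 else 0

/-- The Green kernel of `∂_s^d` on the domain given by `B, C`. -/
def greenKernel {n d : ℕ} (a b : ℝ) (B C : Matrix (Fin d × Fin n) (Fin d × Fin n) ℝ)
    (s θ : ℝ) : Matrix (Fin n) (Fin n) ℝ :=
  if θ ≤ s then
    (blockCol n d 0).transpose *
      (matQ n d (s - θ) - matQ n d (s - a) * (matK a b B C)⁻¹ * C * matQ n d (b - θ)) *
      blockCol n d (d - 1)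
  else
    -((blockCol n d 0).transpose * matQ n d (s - a) * (matK a b B C)⁻¹ * C * matQ n d (b - θ) *
      blockCol n d (d - 1))

theorem continuous_matQ (n d : ℕ) : Continuous (matQ n d) := by
  refine continuous_matrix fun p q => ?_
  simp only [matQ, Matrix.of_apply]
  split_ifs <;> fun_prop


theorem greenKernel_measurable {n d : ℕ} (a b : ℝ)
    (B C : Matrix (Fin d × Fin n) (Fin d × Fin n) ℝ) :
    StronglyMeasurable (fun p : ℝ × ℝ => matCLM (greenKernel a b B C p.1 p.2)) ∧
    ∃ M, 0 ≤ M ∧ ∀ s ∈ Set.Icc a b, ∀ θ ∈ Set.Icc a b, ‖matCLM (greenKernel a b B C s θ)‖ ≤ M := by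
  have h1 : Continuous fun p : ℝ × ℝ => matCLM ((blockCol n d 0).transpose *
      (matQ n d (p.1 - p.2) - matQ n d (p.1 - a) * (matK a b B C)⁻¹ * C * matQ n d (b - p.2)) *
      blockCol n d (d - 1)) := by
    refine continuous_toCLM.comp ?_
    have := continuous_matQ n d
    fun_prop
  have h2 : Continuous fun p : ℝ × ℝ => matCLM (-((blockCol n d 0).transpose *
      matQ n d (p.1 - a) * (matK a b B C)⁻¹ * C * matQ n d (b - p.2) *
      blockCol n d (d - 1))) := by
    refine continuous_toCLM.comp ?_
    have := continuous_matQ n d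
    fun_prop
  constructor
  · have h3 : (fun p : ℝ × ℝ => matCLM (greenKernel a b B C p.1 p.2)) =
      fun p : ℝ × ℝ => if p ∈ {p : ℝ × ℝ | p.2 ≤ p.1} then matCLM ((blockCol n d 0).transpose *
      (matQ n d (p.1 - p.2) - matQ n d (p.1 - a) * (matK a b B C)⁻¹ * C * matQ n d (b - p.2)) *
      blockCol n d (d - 1)) else matCLM (-((blockCol n d 0).transpose *
      matQ n d (p.1 - a) * (matK a b B C)⁻¹ * C * matQ n d (b - p.2) *
      blockCol n d (d - 1))) := by
      funext p
      unfold greenKernel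
      simp only [Set.mem_ofPred_eq]
      split_ifs <;> rfl
    rw [h3]
    exact StronglyMeasurable.ite (measurableSet_le measurable_snd measurable_fst)
      h1.stronglyMeasurable h2.stronglyMeasurable
  · have hK : IsCompact (Set.Icc a b ×ˢ Set.Icc a b) := isCompact_Icc.prod isCompact_Icc
    obtain ⟨c1, hc1⟩ := hK.exists_bound_of_continuousOn h1.continuousOn
    obtain ⟨c2, hc2⟩ := hK.exists_bound_of_continuousOn h2.continuousOn
    refine ⟨max (max c1 c2) 0, le_max_right _ _, fun s hs θ hθ => ?_⟩
    unfold greenKernel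
    split_ifs
    · exact (hc1 (s, θ) ⟨hs, hθ⟩).trans ((le_max_left _ _).trans (le_max_left _ _))
    · exact (hc2 (s, θ) ⟨hs, hθ⟩).trans ((le_max_right _ _).trans (le_max_left _ _))

/-- `s ↦ ∫_a^b G(s,θ) v(θ) dθ`. -/
def greenFun {n d : ℕ} (a b : ℝ) (B C : Matrix (Fin d × Fin n) (Fin d × Fin n) ℝ)
    (v : ℝ → Vec n) (s : ℝ) : Vec n :=
  ∫ θ in Set.Icc a b, matCLM (greenKernel a b B C s θ) (v θ)

section
variable {n d : ℕ} {a b : ℝ} (B C : Matrix (Fin d × Fin n) (Fin d × Fin n) ℝ)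

theorem integrable_green (v : L2 n a b) {s : ℝ} (hs : s ∈ Set.Icc a b) :
    Integrable (fun θ => matCLM (greenKernel a b B C s θ) (v θ))
      (volume.restrict (Set.Icc a b)) := by
  obtain ⟨h1, M, hM0, hM⟩ := greenKernel_measurable a b B C
  refine Integrable.mono' ((L2.integrable v).norm.const_mul M) ?_ ?_
  · exact aesm_clm_apply
      (h1.comp_measurable (measurable_prodMk_left (x := s))).aestronglyMeasurable
      (Lp.aestronglyMeasurable v)
  · filter_upwards [ae_restrict_mem measurableSet_Icc] with θ hθ
    exact (ContinuousLinearMap.le_opNorm _ _).trans (by gcongr; exact hM s hs θ hθ)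

theorem greenFun_bound :
    ∃ M, 0 ≤ M ∧ ∀ v : L2 n a b, ∀ s ∈ Set.Icc a b, ‖greenFun a b B C v s‖ ≤ M * ‖v‖ := by
  obtain ⟨h1, M, hM0, hM⟩ := greenKernel_measurable a b B C
  obtain ⟨K, hK0, hK⟩ := integral_norm_le (n := n) a b
  refine ⟨M * K, by positivity, fun v s hs => ?_⟩
  calc ‖greenFun a b B C v s‖ ≤ ∫ θ in Set.Icc a b, M * ‖v θ‖ := by
        refine norm_integral_le_of_norm_le ((L2.integrable v).norm.const_mul _) ?_
        filter_upwards [ae_restrict_mem measurableSet_Icc] with θ hθ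
        exact (ContinuousLinearMap.le_opNorm _ _).trans (by gcongr; exact hM s hs θ hθ)
    _ = M * ∫ s in Set.Icc a b, ‖v s‖ := integral_const_mul _ _
    _ ≤ M * (K * ‖v‖) := by gcongr; exact hK v
    _ = M * K * ‖v‖ := by ring

theorem memLp_green (v : L2 n a b) :
    MemLp (greenFun a b B C v) 2 (volume.restrict (Set.Icc a b)) := by
  obtain ⟨h1, -⟩ := greenKernel_measurable a b B C
  obtain ⟨M, hM0, hM⟩ := greenFun_bound (a := a) (b := b) B C
  refine MemLp.of_bound ?_ (M * ‖v‖) ?_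
  · have h2 : AEStronglyMeasurable
        (fun p : ℝ × ℝ => matCLM (greenKernel a b B C p.1 p.2) (v p.2))
        ((volume.restrict (Set.Icc a b)).prod (volume.restrict (Set.Icc a b))) :=
      aesm_clm_apply h1.aestronglyMeasurable
        ((Lp.aestronglyMeasurable v).comp_quasiMeasurePreserving
          Measure.quasiMeasurePreserving_snd)
    exact h2.integral_prod_right'
  · filter_upwards [ae_restrict_mem measurableSet_Icc] with s hs
    exact hM v s hs

/-- The operator `𝒯` on `L₂ⁿ[a,b]`, `(𝒯 v)(s) = ∫_a^b G(s,θ) v(θ) dθ`. -/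
def greenOp : L2 n a b →L[ℝ] L2 n a b :=
  LinearMap.mkContinuousOfExistsBound
    { toFun := fun v => (memLp_green B C v).toLp
      map_add' := fun u v => by
        apply Lp.ext
        refine (MemLp.coeFn_toLp _).trans (EventuallyEq.trans ?_ (Lp.coeFn_add _ _).symm)
        filter_upwards [(memLp_green B C u).coeFn_toLp, (memLp_green B C v).coeFn_toLp,
          ae_restrict_mem measurableSet_Icc] with s h2 h3 hs
        rw [Pi.add_apply, h2, h3, greenFun, greenFun, greenFun,
          ← integral_add (integrable_green B C u hs) (integrable_green B C v hs)]
        apply integral_congr_ae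
        filter_upwards [Lp.coeFn_add u v] with θ h1
        rw [h1, Pi.add_apply, map_add]
      map_smul' := fun c u => by
        apply Lp.ext
        refine (MemLp.coeFn_toLp _).trans (EventuallyEq.trans ?_ (Lp.coeFn_smul _ _).symm)
        filter_upwards [(memLp_green B C u).coeFn_toLp] with s h2
        rw [Pi.smul_apply, h2, greenFun, greenFun, RingHom.id_apply, ← integral_smul]
        apply integral_congr_ae
        filter_upwards [Lp.coeFn_smul c u] with θ h1
        rw [h1, Pi.smul_apply, map_smul] }
    (by
      obtain ⟨M, hM0, hM⟩ := greenFun_bound (a := a) (b := b) B C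
      refine ⟨(volume.restrict (Set.Icc a b)).real Set.univ ^ (2 : ENNReal).toReal⁻¹ * M,
        fun v => ?_⟩
      rw [mul_assoc]
      refine Lp.norm_le_of_ae_bound (by positivity) ?_
      filter_upwards [(memLp_green B C v).coeFn_toLp,
        ae_restrict_mem measurableSet_Icc] with s h1 hs
      exact (congrArg norm h1).trans_le (hM v s hs))

end


/-- The domain `D` of all `u ∈ W₂^{d,n}[a,b]` with
`∑_j (B_{i,j} ∂_s^j u(a) + C_{i,j} ∂_s^j u(b)) = 0` for all `i`, where `i, j` range over
`0, …, d-1`; the boundary values are those of the continuous representatives `f j` of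
`∂_s^j u`. -/
def pieDomain {n d : ℕ} (a b : ℝ) (B C : Matrix (Fin d × Fin n) (Fin d × Fin n) ℝ) :
    Submodule ℝ (L2 n a b) where
  carrier := {u | ∃ hu : u ∈ sobolev n d a b, ∃ f : Fin d → ℝ → Vec n,
    (∀ j, ContinuousOn (f j) (Set.Icc a b) ∧
      weakDeriv j.castSucc ⟨u, hu⟩ =ᵐ[volume.restrict (Set.Icc a b)] f j) ∧
    ∀ i, ∑ j, (matCLM (block B i j) (f j a) + matCLM (block C i j) (f j b)) = 0}
  add_mem' := by
    rintro u u' ⟨hu, f, hf, hB⟩ ⟨hu', f', hf', hB'⟩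
    refine ⟨add_mem hu hu', fun j s => f j s + f' j s,
      fun j => ⟨(hf j).1.add (hf' j).1, ?_⟩, fun i => ?_⟩
    · have e : weakDeriv j.castSucc ⟨u + u', add_mem hu hu'⟩
          = weakDeriv j.castSucc ⟨u, hu⟩ + weakDeriv j.castSucc ⟨u', hu'⟩ :=
        map_add (weakDeriv j.castSucc) (⟨u, hu⟩ : sobolev n d a b) ⟨u', hu'⟩
      rw [e]
      exact (Lp.coeFn_add _ _).trans ((hf j).2.add (hf' j).2)
    · rw [← add_zero (0 : Vec n)]
      nth_rewrite 1 [← hB i]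
      rw [← hB' i, ← Finset.sum_add_distrib]
      refine Finset.sum_congr rfl fun j _ => ?_
      simp only [map_add]
      abel
  zero_mem' := by
    refine ⟨zero_mem _, fun _ _ => 0, fun j => ⟨continuousOn_const, ?_⟩, fun i => by simp⟩
    have e : weakDeriv j.castSucc ⟨0, zero_mem (sobolev n d a b)⟩ = 0 :=
      map_zero (weakDeriv j.castSucc)
    rw [e]
    exact Lp.coeFn_zero _ _ _
  smul_mem' := by
    rintro c u ⟨hu, f, hf, hB⟩
    refine ⟨Submodule.smul_mem _ c hu, fun j s => c • f j s,
      fun j => ⟨(hf j).1.const_smul c, ?_⟩, fun i => ?_⟩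
    · have e : weakDeriv j.castSucc ⟨c • u, Submodule.smul_mem _ c hu⟩
          = c • weakDeriv j.castSucc ⟨u, hu⟩ :=
        map_smul (weakDeriv j.castSucc) c (⟨u, hu⟩ : sobolev n d a b)
      rw [e]
      exact (Lp.coeFn_smul _ _).trans ((hf j).2.const_smul c)
    · have := congrArg (c • ·) (hB i)
      simpa [Finset.smul_sum] using this

theorem pieDomain_le_sobolev {n d : ℕ} {a b : ℝ}
    (B C : Matrix (Fin d × Fin n) (Fin d × Fin n) ℝ) :
    pieDomain a b B C ≤ sobolev n d a b :=
  fun _ hu => hu.1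

/-- The differential operator `A u = ∑_{k ≤ d} A_k(s) ∂_s^k u` with domain `D`. -/
def diffOp {n d : ℕ} (a b : ℝ) (B C : Matrix (Fin d × Fin n) (Fin d × Fin n) ℝ)
    (A : Fin (d + 1) → Matrix (Fin n) (Fin n) ℝ[X]) : pieDomain a b B C →ₗ[ℝ] L2 n a b :=
  ∑ k, (mulOp (A k)).toLinearMap ∘ₗ weakDeriv k ∘ₗ
    Submodule.inclusion (pieDomain_le_sobolev B C)

def iterInt (a : ℝ) (m : ℕ) (v : ℝ → ℝ) (s : ℝ) : ℝ :=
  ∫ θ in a..s, (s - θ) ^ m / m.factorial * v θ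

theorem iterInt_succ {a b : ℝ} (m : ℕ) {v : ℝ → ℝ} (hv : IntervalIntegrable v volume a b) {s : ℝ}
    (hs : s ∈ Set.Icc a b) :
    iterInt a (m + 1) v s = iterInt a m (fun t => ∫ θ in a..t, v θ) s := by
  have hv' : IntervalIntegrable v volume a s :=
    hv.mono_set (by rw [Set.uIcc_of_le hs.1, Set.uIcc_of_le (hs.1.trans hs.2)]
                    exact Set.Icc_subset_Icc_right hs.2)
  have hV := hv'.absolutelyContinuousOnInterval_intervalIntegral (c := a) (by simp)
  have hd : ∀ θ : ℝ, HasDerivAt (fun θ : ℝ => (s - θ) ^ (m + 1) / (m + 1).factorial)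
      (-((s - θ) ^ m / m.factorial)) θ := by
    intro θ
    have h := (((hasDerivAt_id θ).const_sub s).pow (m + 1)).div_const ((m + 1).factorial : ℝ)
    refine h.congr_deriv ?_
    have : (m.factorial : ℝ) ≠ 0 := by positivity
    rw [Nat.factorial_succ]
    push_cast
    simp only [id]
    field_simp
  have hf : AbsolutelyContinuousOnInterval
      (fun θ : ℝ => (s - θ) ^ (m + 1) / (m + 1).factorial) a s := by
    refine ContDiffOn.absolutelyContinuousOnInterval (ContDiff.contDiffOn ?_)
    fun_prop
  have h := hf.integral_mul_deriv_eq_deriv_mul hV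
  have e1 : iterInt a (m + 1) v s = ∫ x in a..s, (s - x) ^ (m + 1) / (m + 1).factorial *
      deriv (fun t => ∫ θ in a..t, v θ) x := by
    unfold iterInt
    apply intervalIntegral.integral_congr_ae
    filter_upwards [hv'.ae_hasDerivAt_integral] with x hx hx'
    rw [(hx (Set.uIoc_subset_uIcc hx') a (by simp)).deriv]
  rw [e1, h]
  simp only [sub_self, intervalIntegral.integral_same, (hd _).deriv, iterInt]
  simp

theorem iterInt_eq_integral {a b : ℝ} (m : ℕ) {v : ℝ → ℝ} (hv : IntervalIntegrable v volume a b)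
    {s : ℝ} (hs : s ∈ Set.Icc a b) :
    iterInt a (m + 1) v s = ∫ t in a..s, iterInt a m v t := by
  have hab : a ≤ b := hs.1.trans hs.2
  induction m generalizing v s with
  | zero =>
    rw [iterInt_succ 0 hv hs]
    simp [iterInt]
  | succ m ih =>
    have hV : IntervalIntegrable (fun t => ∫ θ in a..t, v θ) volume a b :=
      (hv.absolutelyContinuousOnInterval_intervalIntegral (c := a)
        (by simp)).continuousOn.intervalIntegrable
    rw [iterInt_succ (m + 1) hv hs, ih hV hs]
    apply intervalIntegral.integral_congr
    intro t ht
    rw [Set.uIcc_of_le hs.1] at ht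
    exact (iterInt_succ m hv ⟨ht.1, ht.2.trans hs.2⟩).symm

theorem iterInt_zero (a : ℝ) (v : ℝ → ℝ) (s : ℝ) : iterInt a 0 v s = ∫ t in a..s, v t := by
  simp [iterInt]

/-- `j`-th component of the solution of the initial value problem -/
def chain (d : ℕ) (a : ℝ) (c : Fin d → ℝ) (v : ℝ → ℝ) (j : ℕ) (s : ℝ) : ℝ :=
  if j < d then
    (∑ l : Fin d, if j ≤ l.val then (s - a) ^ (l.val - j) / (l.val - j).factorial * c l else 0)
      + iterInt a (d - 1 - j) v s
  else v s

theorem poly_deriv (d : ℕ) (a : ℝ) (c : Fin d → ℝ) (j : ℕ) (s : ℝ) :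
    HasDerivAt (fun s : ℝ => ∑ l : Fin d,
      if j ≤ l.val then (s - a) ^ (l.val - j) / (l.val - j).factorial * c l else 0)
      (∑ l : Fin d, if j + 1 ≤ l.val then
        (s - a) ^ (l.val - (j + 1)) / (l.val - (j + 1)).factorial * c l else 0) s := by
  refine HasDerivAt.fun_sum fun l _ => ?_
  by_cases h1 : j + 1 ≤ l.val
  · simp only [h1, if_true, (Nat.le_succ j).trans h1]
    obtain ⟨m, hm⟩ := Nat.exists_eq_add_of_le h1
    have e1 : l.val - j = m + 1 := by omega
    have e2 : l.val - (j + 1) = m := by omega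
    rw [e1, e2]
    have h := ((((hasDerivAt_id s).sub_const a).pow (m + 1)).div_const
      ((m + 1).factorial : ℝ)).mul_const (c l)
    refine h.congr_deriv ?_
    have : (m.factorial : ℝ) ≠ 0 := by positivity
    rw [Nat.factorial_succ]
    push_cast
    simp only [id]
    field_simp
  · simp only [h1, if_false]
    by_cases h2 : j ≤ l.val
    · have e1 : l.val - j = 0 := by omega
      simp only [h2, if_true, e1, pow_zero]
      exact hasDerivAt_const _ _
    · simp only [h2, if_false]
      exact hasDerivAt_const _ _

theorem chain_step {d : ℕ} {a b : ℝ} (hab : a ≤ b) (c : Fin d → ℝ) {v : ℝ → ℝ}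
    (hv : IntervalIntegrable v volume a b) {j : ℕ} (hj : j < d) :
    ContinuousOn (chain d a c v j) (Set.Icc a b) ∧
    IntervalIntegrable (chain d a c v (j + 1)) volume a b ∧
    ∀ s ∈ Set.Icc a b, chain d a c v j s = chain d a c v j a
      + ∫ t in a..s, chain d a c v (j + 1) t := by
  have hJ : ∀ m, ContinuousOn (iterInt a m v) (Set.Icc a b) := by
    intro m
    have key : ∀ g : ℝ → ℝ, IntervalIntegrable g volume a b →
        ContinuousOn (fun s => ∫ t in a..s, g t) (Set.Icc a b) := by
      intro g hg
      rw [← Set.uIcc_of_le hab]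
      exact (hg.absolutelyContinuousOnInterval_intervalIntegral (c := a) (by simp)).continuousOn
    induction m with
    | zero => exact (key v hv).congr fun s _ => iterInt_zero a v s
    | succ m ih =>
      refine (key (iterInt a m v) ?_).congr fun s hs => iterInt_eq_integral m hv hs
      exact ContinuousOn.intervalIntegrable (by rwa [Set.uIcc_of_le hab])
  have hpc : ∀ j, Continuous (fun s : ℝ => ∑ l : Fin d,
      if j ≤ l.val then (s - a) ^ (l.val - j) / (l.val - j).factorial * c l else 0) := by
    intro j
    exact continuous_iff_continuousAt.2 fun s => (poly_deriv d a c j s).continuousAt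
  have hpi : ∀ j s, (∑ l : Fin d, if j ≤ l.val then
        (s - a) ^ (l.val - j) / (l.val - j).factorial * c l else 0)
      = (∑ l : Fin d, if j ≤ l.val then
        (a - a) ^ (l.val - j) / (l.val - j).factorial * c l else 0)
      + ∫ t in a..s, ∑ l : Fin d, if j + 1 ≤ l.val then
        (t - a) ^ (l.val - (j + 1)) / (l.val - (j + 1)).factorial * c l else 0 := by
    intro j s
    rw [intervalIntegral.integral_eq_sub_of_hasDerivAt (fun t _ => poly_deriv d a c j t)
      ((hpc (j + 1)).intervalIntegrable _ _)]
    ring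
  have hJi : ∀ m, ∀ s ∈ Set.Icc a b, IntervalIntegrable (iterInt a m v) volume a s :=
    fun m s hs => ContinuousOn.intervalIntegrable
      (by rw [Set.uIcc_of_le hs.1]; exact (hJ m).mono (Set.Icc_subset_Icc_right hs.2))
  have hcont : ∀ j, j < d → ContinuousOn (chain d a c v j) (Set.Icc a b) := by
    intro j hj
    refine ContinuousOn.congr ((hpc j).continuousOn.add (hJ (d - 1 - j))) fun s _ => ?_
    simp [chain, hj]
  have hJa : ∀ m, iterInt a m v a = 0 := fun m => by simp [iterInt]
  refine ⟨hcont j hj, ?_, ?_⟩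
  · by_cases h1 : j + 1 < d
    · exact ContinuousOn.intervalIntegrable (by rw [Set.uIcc_of_le hab]; exact hcont _ h1)
    · have : chain d a c v (j + 1) = v := by funext s; simp [chain, h1]
      rw [this]; exact hv
  · intro s hs
    by_cases h1 : j + 1 < d
    · simp only [chain, hj, h1, if_true, hJa, add_zero]
      rw [intervalIntegral.integral_add ((hpc (j + 1)).intervalIntegrable _ _) (hJi _ s hs),
        hpi j s]
      have e : d - 1 - j = (d - 1 - (j + 1)) + 1 := by omega
      rw [e, iterInt_eq_integral _ hv hs]
      ring
    · have e : d - 1 - j = 0 := by omega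
      simp only [chain, hj, h1, if_true, if_false, hJa, add_zero, e]
      rw [hpi j s, iterInt_zero]
      have e2 : ∀ t : ℝ, (∑ l : Fin d, if j + 1 ≤ l.val then
        (t - a) ^ (l.val - (j + 1)) / (l.val - (j + 1)).factorial * c l else 0) = 0 := by
        intro t
        refine Finset.sum_eq_zero fun l _ => ?_
        rw [if_neg]
        have := l.2
        omega
      simp only [e2, intervalIntegral.integral_zero, add_zero]

theorem chain_test {d : ℕ} {a b : ℝ} (hab : a ≤ b) (c : Fin d → ℝ) {v : ℝ → ℝ}
    (hv : IntervalIntegrable v volume a b) {k : ℕ} (hk : k ≤ d) {φ : ℝ → ℝ}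
    (hφ : ContDiff ℝ ∞ φ) (hs : tsupport φ ⊆ Set.Ioo a b) :
    ∫ s in a..b, iteratedDeriv k φ s * chain d a c v 0 s
      = (-1) ^ k * ∫ s in a..b, φ s * chain d a c v k s := by
  induction k generalizing φ with
  | zero => simp
  | succ k ih =>
    obtain ⟨-, hg, hF⟩ := chain_step hab c hv (Nat.lt_of_succ_le hk)
    have hφ' : ContDiff ℝ ∞ (deriv φ) := (contDiff_infty_iff_deriv.1 hφ).2
    rw [iteratedDeriv_succ', ih (Nat.le_of_succ_le hk) hφ' (tsupport_deriv_subset.trans hs)]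
    set g := chain d a c v (k + 1) with hgdef
    set F := chain d a c v k with hFdef
    have hφac : AbsolutelyContinuousOnInterval φ a b :=
      ContDiffOn.absolutelyContinuousOnInterval (hφ.of_le (by exact_mod_cast le_top)).contDiffOn
    have hc : AbsolutelyContinuousOnInterval (fun _ : ℝ => F a) a b :=
      ContDiffOn.absolutelyContinuousOnInterval contDiff_const.contDiffOn
    have hGac := hc.add (hg.absolutelyContinuousOnInterval_intervalIntegral (c := a) (by simp))
    have h := hφac.integral_mul_deriv_eq_deriv_mul hGac
    have ha : φ a = 0 := image_eq_zero_of_notMem_tsupport fun h => lt_irrefl _ (hs h).1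
    have hb : φ b = 0 := image_eq_zero_of_notMem_tsupport fun h => lt_irrefl _ (hs h).2
    rw [ha, hb, zero_mul, zero_mul, sub_zero, zero_sub] at h
    have e1 : ∫ s in a..b, deriv φ s * F s = ∫ x in a..b, deriv φ x *
        ((fun _ : ℝ => F a) + fun x => ∫ t in a..x, g t) x := by
      apply intervalIntegral.integral_congr
      intro s hs
      rw [Set.uIcc_of_le hab] at hs
      simp only [Pi.add_apply]
      rw [hF s hs]
    have e2 : ∫ s in a..b, φ s * g s = ∫ x in a..b, φ x *
        deriv ((fun _ : ℝ => F a) + fun x => ∫ t in a..x, g t) x := by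
      apply intervalIntegral.integral_congr_ae
      filter_upwards [hg.ae_hasDerivAt_integral] with x hx hx'
      have := (hasDerivAt_const x (F a)).add (hx (Set.uIoc_subset_uIcc hx') a (by simp))
      rw [this.deriv, zero_add]
    rw [e1, e2, h, pow_succ]
    ring

theorem intervalIntegrable_coord {n : ℕ} {a b : ℝ} (hab : a ≤ b) (v : L2 n a b) (p : Fin n) :
    IntervalIntegrable (fun s => v s p) volume a b := by
  rw [intervalIntegrable_iff_integrableOn_Icc_of_le hab]
  exact (EuclideanSpace.proj (𝕜 := ℝ) p).integrable_comp (L2.integrable v)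

/-- moments of `v` and initial data of the solution of the boundary value problem -/
def moment {n d : ℕ} (a b : ℝ) (v : ℝ → Vec n) : Fin d × Fin n → ℝ :=
  fun x => iterInt a (d - 1 - x.1.val) (fun θ => v θ x.2) b

def initData {n d : ℕ} (a b : ℝ) (B C : Matrix (Fin d × Fin n) (Fin d × Fin n) ℝ)
    (v : ℝ → Vec n) : Fin d × Fin n → ℝ :=
  -(((matK a b B C)⁻¹ * C).mulVec (moment a b v))

def stateVec {n d : ℕ} (a b : ℝ) (B C : Matrix (Fin d × Fin n) (Fin d × Fin n) ℝ)
    (v : ℝ → Vec n) (j : ℕ) (s : ℝ) : Vec n :=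
  WithLp.toLp 2 fun p =>
    chain d a (fun l => initData a b B C v (l, p)) (fun θ => v θ p) j s

theorem matQ_mul_last {n d : ℕ} (hd : 0 < d) (z : ℝ) (p : Fin d × Fin n) (q : Fin n) :
    (matQ n d z * blockCol n d (d - 1)) p q
      = if p.2 = q then z ^ (d - 1 - p.1.val) / (d - 1 - p.1.val).factorial else 0 := by
  rw [Matrix.mul_apply, Finset.sum_eq_single (⟨d - 1, by omega⟩, q)]
  · have h : p.1 ≤ (⟨d - 1, by omega⟩ : Fin d) := by
      rw [Fin.le_def]; have := p.1.2; simp only; omega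
    simp [matQ, blockCol, h]
  · intro x _ hx
    have : ¬ (x.1.val = d - 1 ∧ x.2 = q) := by
      rintro ⟨h1, h2⟩
      exact hx (Prod.ext (Fin.ext h1) h2)
    simp [blockCol, this]
  · simp

theorem first_mul {n d : ℕ} {α : Type*} [Fintype α] (hd : 0 < d) (M : Matrix (Fin d × Fin n) α ℝ)
    (p : Fin n) (x : α) :
    ((blockCol n d 0).transpose * M) p x = M (⟨0, hd⟩, p) x := by
  rw [Matrix.mul_apply, Finset.sum_eq_single (⟨0, hd⟩, p)]
  · simp [blockCol]
  · intro x _ hx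
    have : ¬ (x.1.val = 0 ∧ x.2 = p) := by
      rintro ⟨h1, h2⟩
      exact hx (Prod.ext (Fin.ext h1) h2)
    simp [blockCol, this]
  · simp

theorem greenFun_eq {n d : ℕ} {a b : ℝ} (hab : a ≤ b) (hd : 0 < d)
    (B C : Matrix (Fin d × Fin n) (Fin d × Fin n) ℝ) (v : L2 n a b) {s : ℝ}
    (hs : s ∈ Set.Icc a b) :
    greenFun a b B C v s = stateVec a b B C v 0 s := by
  ext p
  have hint := integrable_green B C v hs
  have e1 : greenFun a b B C v s p
      = ∫ θ in Set.Icc a b, (matCLM (greenKernel a b B C s θ) (v θ)) p := by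
    exact ((EuclideanSpace.proj (𝕜 := ℝ) p).integral_comp_comm hint).symm
  set R : Fin d × Fin n → ℝ :=
    fun x => (matQ n d (s - a) * (matK a b B C)⁻¹ * C) (⟨0, hd⟩, p) x with hR
  have hvi : ∀ q, Integrable (fun θ => v θ q) (volume.restrict (Set.Icc a b)) := fun q =>
    (EuclideanSpace.proj (𝕜 := ℝ) q).integrable_comp (L2.integrable v)
  have e2 : ∀ θ, (matCLM (greenKernel a b B C s θ) (v θ)) p
      = (Set.Iic s).indicator (fun θ => (s - θ) ^ (d - 1) / (d - 1).factorial * v θ p) θ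
        - ∑ x : Fin d × Fin n, R x *
          ((b - θ) ^ (d - 1 - x.1.val) / (d - 1 - x.1.val).factorial * v θ x.2) := by
    intro θ
    have hM : ∀ M : Matrix (Fin n) (Fin n) ℝ, (matCLM M (v θ)) p = ∑ q, M p q * v θ q := fun M => rfl
    have hS : ∀ q, ((blockCol n d 0).transpose * matQ n d (s - a) * (matK a b B C)⁻¹ * C *
        matQ n d (b - θ) * blockCol n d (d - 1)) p q = ∑ x : Fin d × Fin n, R x *
        if x.2 = q then (b - θ) ^ (d - 1 - x.1.val) / (d - 1 - x.1.val).factorial else 0 := by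
      intro q
      have : (blockCol n d 0).transpose * matQ n d (s - a) * (matK a b B C)⁻¹ * C *
        matQ n d (b - θ) * blockCol n d (d - 1) = (blockCol n d 0).transpose *
        ((matQ n d (s - a) * (matK a b B C)⁻¹ * C) *
        (matQ n d (b - θ) * blockCol n d (d - 1))) := by
        simp only [Matrix.mul_assoc]
      rw [this, first_mul hd, Matrix.mul_apply]
      exact Finset.sum_congr rfl fun x _ => by rw [matQ_mul_last hd]
    have hSs : ∑ q, ((blockCol n d 0).transpose * matQ n d (s - a) * (matK a b B C)⁻¹ * C *
        matQ n d (b - θ) * blockCol n d (d - 1)) p q * v θ q = ∑ x : Fin d × Fin n, R x *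
          ((b - θ) ^ (d - 1 - x.1.val) / (d - 1 - x.1.val).factorial * v θ x.2) := by
      simp only [hS, Finset.sum_mul]
      rw [Finset.sum_comm]
      refine Finset.sum_congr rfl fun x _ => ?_
      rw [Finset.sum_eq_single x.2]
      · simp [mul_assoc]
      · intro q _ hq
        simp [hq.symm]
      · simp
    rw [hM]
    by_cases hθ : θ ≤ s
    · rw [Set.indicator_of_mem (by exact hθ), ← hSs]
      have hQ : ∀ q, ((blockCol n d 0).transpose * matQ n d (s - θ) * blockCol n d (d - 1)) p q
          = if p = q then (s - θ) ^ (d - 1) / (d - 1).factorial else 0 := by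
        intro q
        rw [Matrix.mul_assoc, first_mul hd, matQ_mul_last hd]
        simp
      simp only [greenKernel, hθ, if_true, Matrix.mul_sub, Matrix.sub_mul, Matrix.sub_apply, hQ,
        sub_mul, Finset.sum_sub_distrib, ← Matrix.mul_assoc]
      simp
    · rw [Set.indicator_of_notMem (by exact hθ), ← hSs, zero_sub]
      simp only [greenKernel, hθ, if_false, Matrix.neg_apply, neg_mul, Finset.sum_neg_distrib]
  have hterm : ∀ x : Fin d × Fin n, Integrable (fun θ => R x *
      ((b - θ) ^ (d - 1 - x.1.val) / (d - 1 - x.1.val).factorial * v θ x.2))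
      (volume.restrict (Set.Icc a b)) := by
    intro x
    refine Integrable.const_mul ?_ _
    have hg : ContinuousOn (fun θ : ℝ => (b - θ) ^ (d - 1 - x.1.val) /
      ((d - 1 - x.1.val).factorial : ℝ)) (Set.Icc a b) := by fun_prop
    exact IntegrableOn.continuousOn_mul hg (hvi x.2) isCompact_Icc
  have hfirst : Integrable ((Set.Iic s).indicator
      (fun θ => (s - θ) ^ (d - 1) / (d - 1).factorial * v θ p))
      (volume.restrict (Set.Icc a b)) := by
    refine Integrable.indicator ?_ measurableSet_Iic
    have hg : ContinuousOn (fun θ : ℝ => (s - θ) ^ (d - 1) /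
      ((d - 1).factorial : ℝ)) (Set.Icc a b) := by fun_prop
    exact IntegrableOn.continuousOn_mul hg (hvi p) isCompact_Icc
  rw [e1, integral_congr_ae (ae_of_all _ e2), integral_sub hfirst
    (integrable_finsetSum _ fun x _ => hterm x), integral_finsetSum _ fun x _ => hterm x]
  have e3 : ∫ θ in Set.Icc a b, (Set.Iic s).indicator
      (fun θ => (s - θ) ^ (d - 1) / (d - 1).factorial * v θ p) θ
      = iterInt a (d - 1) (fun θ => v θ p) s := by
    rw [integral_indicator measurableSet_Iic, Measure.restrict_restrict measurableSet_Iic, iterInt,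
      intervalIntegral.integral_of_le hs.1, ← integral_Icc_eq_integral_Ioc]
    congr 2
    ext x
    simp only [Set.mem_inter_iff, Set.mem_Iic, Set.mem_Icc]
    constructor
    · rintro ⟨h1, h2, h3⟩; exact ⟨h2, h1⟩
    · rintro ⟨h1, h2⟩; exact ⟨h2, h1, h2.trans hs.2⟩
  have e4 : ∀ x : Fin d × Fin n, ∫ θ in Set.Icc a b, R x *
      ((b - θ) ^ (d - 1 - x.1.val) / (d - 1 - x.1.val).factorial * v θ x.2)
      = R x * moment a b v x := by
    intro x
    rw [integral_const_mul, moment, iterInt, intervalIntegral.integral_of_le hab,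
      integral_Icc_eq_integral_Ioc]
  rw [e3, Finset.sum_congr rfl fun x _ => e4 x]
  have e5 : stateVec a b B C v 0 s p
    = chain d a (fun l => initData a b B C v (l, p)) (fun θ => v θ p) 0 s := rfl
  rw [e5, chain, if_pos hd]
  have e6 : ∑ x, R x * moment a b v x
      = ((matQ n d (s - a)).mulVec (((matK a b B C)⁻¹ * C).mulVec (moment a b v)))
        (⟨0, hd⟩, p) := by
    rw [Matrix.mulVec_mulVec, ← Matrix.mul_assoc]; rfl
  have e7 : ∀ y : Fin d × Fin n → ℝ, (matQ n d (s - a)).mulVec y (⟨0, hd⟩, p)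
      = ∑ l : Fin d, (s - a) ^ l.val / l.val.factorial * y (l, p) := by
    intro y
    rw [Matrix.mulVec, dotProduct, Fintype.sum_prod_type]
    refine Finset.sum_congr rfl fun l _ => ?_
    rw [Finset.sum_eq_single p]
    · have : (⟨0, hd⟩ : Fin d) ≤ l := by rw [Fin.le_def]; exact Nat.zero_le _
      simp [matQ, this]
    · intro q _ hq
      simp [matQ, hq.symm]
    · simp
  rw [e6, e7]
  simp only [Nat.zero_le, if_true, Nat.sub_zero, initData, Pi.neg_apply, mul_neg,
    Finset.sum_neg_distrib]
  ring

theorem stateVec_top {n d : ℕ} (a b : ℝ) (B C : Matrix (Fin d × Fin n) (Fin d × Fin n) ℝ)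
    (v : ℝ → Vec n) : stateVec a b B C v d = v := by
  funext s
  ext p
  simp [stateVec, chain]

theorem stateVec_continuousOn {n d : ℕ} {a b : ℝ} (hab : a ≤ b)
    (B C : Matrix (Fin d × Fin n) (Fin d × Fin n) ℝ) (v : L2 n a b) {j : ℕ} (hj : j < d) :
    ContinuousOn (stateVec a b B C v j) (Set.Icc a b) := by
  refine (PiLp.continuous_toLp 2 _).comp_continuousOn (continuousOn_pi.2 fun p => ?_)
  exact (chain_step hab _ (intervalIntegrable_coord hab v p) hj).1

theorem stateVec_memLp {n d : ℕ} {a b : ℝ} (hab : a ≤ b)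
    (B C : Matrix (Fin d × Fin n) (Fin d × Fin n) ℝ) (v : L2 n a b) {j : ℕ} (hj : j ≤ d) :
    MemLp (stateVec a b B C v j) 2 (volume.restrict (Set.Icc a b)) := by
  rcases hj.lt_or_eq with hj | rfl
  · have hc := stateVec_continuousOn hab B C v hj
    obtain ⟨M, hM⟩ := isCompact_Icc.exists_bound_of_continuousOn hc
    refine MemLp.of_bound (hc.aestronglyMeasurable measurableSet_Icc) M ?_
    filter_upwards [ae_restrict_mem measurableSet_Icc] with s hs
    exact hM s hs
  · rw [stateVec_top]
    exact Lp.memLp v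

theorem stateVec_weakDeriv {n d : ℕ} {a b : ℝ} (hab : a ≤ b)
    (B C : Matrix (Fin d × Fin n) (Fin d × Fin n) ℝ) (v : L2 n a b) {k : ℕ} (hk : k ≤ d) :
    HasWeakDeriv a b k (stateVec a b B C v 0) (stateVec a b B C v k) := by
  intro φ hφ hc hs
  have hint : ∀ (j : ℕ), j ≤ d → ∀ ψ : ℝ → ℝ, Continuous ψ →
      Integrable (fun s => ψ s • stateVec a b B C v j s) (volume.restrict (Set.Icc a b)) := by
    intro j hj ψ hψ
    have h1 : IntegrableOn (stateVec a b B C v j) (Set.Icc a b) :=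
      (stateVec_memLp hab B C v hj).integrable (by norm_num)
    exact h1.continuousOn_smul hψ.continuousOn isCompact_Icc
  have hcoord : ∀ (j : ℕ), j ≤ d → ∀ ψ : ℝ → ℝ, Continuous ψ → ∀ p : Fin n,
      (∫ s in Set.Icc a b, ψ s • stateVec a b B C v j s) p
        = ∫ s in a..b, ψ s * chain d a (fun l => initData a b B C v (l, p))
          (fun θ => v θ p) j s := by
    intro j hj ψ hψ p
    rw [intervalIntegral.integral_of_le hab, ← integral_Icc_eq_integral_Ioc]
    exact ((EuclideanSpace.proj (𝕜 := ℝ) p).integral_comp_comm (hint j hj ψ hψ)).symm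
  ext p
  rw [hcoord 0 (Nat.zero_le d) _ (continuous_iteratedDeriv_test hφ k) p, PiLp.smul_apply,
    hcoord k hk _ hφ.continuous p, smul_eq_mul,
    chain_test hab _ (intervalIntegrable_coord hab v p) hk hφ hs]

theorem HasWeakDeriv.congr {n : ℕ} {a b : ℝ} {k : ℕ} {u u' w w' : ℝ → Vec n}
    (h : HasWeakDeriv a b k u w) (hu : u' =ᵐ[volume.restrict (Set.Icc a b)] u)
    (hw : w' =ᵐ[volume.restrict (Set.Icc a b)] w) : HasWeakDeriv a b k u' w' := by
  intro φ hφ hc hs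
  have := h φ hφ hc hs
  rw [integral_congr_ae (g := fun s => iteratedDeriv k φ s • u s), this]
  · congr 1
    apply integral_congr_ae
    filter_upwards [hw] with s hs
    rw [hs]
  · filter_upwards [hu] with s hs
    rw [hs]

theorem greenOp_coeFn {n d : ℕ} {a b : ℝ} (hab : a ≤ b) (hd : 0 < d)
    (B C : Matrix (Fin d × Fin n) (Fin d × Fin n) ℝ) (v : L2 n a b) :
    greenOp B C v =ᵐ[volume.restrict (Set.Icc a b)] stateVec a b B C v 0 := by
  have h : greenOp B C v =ᵐ[volume.restrict (Set.Icc a b)] greenFun a b B C v :=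
    (memLp_green B C v).coeFn_toLp
  filter_upwards [h, ae_restrict_mem measurableSet_Icc] with s h1 hs
  rw [h1, greenFun_eq hab hd B C v hs]

theorem greenOp_weakDeriv {n d : ℕ} {a b : ℝ} (hab : a ≤ b) (hd : 0 < d)
    (B C : Matrix (Fin d × Fin n) (Fin d × Fin n) ℝ) (v : L2 n a b) (k : Fin (d + 1)) :
    HasWeakDeriv a b k (greenOp B C v)
      ((stateVec_memLp hab B C v (Nat.lt_succ_iff.1 k.2)).toLp : L2 n a b) :=
  (stateVec_weakDeriv hab B C v (Nat.lt_succ_iff.1 k.2)).congr (greenOp_coeFn hab hd B C v)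
    (MemLp.coeFn_toLp _)

theorem greenOp_mem_sobolev {n d : ℕ} {a b : ℝ} (hab : a ≤ b) (hd : 0 < d)
    (B C : Matrix (Fin d × Fin n) (Fin d × Fin n) ℝ) (v : L2 n a b) :
    greenOp B C v ∈ sobolev n d a b :=
  fun k => ⟨_, greenOp_weakDeriv hab hd B C v k⟩

theorem weakDeriv_greenOp {n d : ℕ} {a b : ℝ} (hab : a ≤ b) (hd : 0 < d)
    (B C : Matrix (Fin d × Fin n) (Fin d × Fin n) ℝ) (v : L2 n a b) (k : Fin (d + 1)) :
    weakDeriv k ⟨greenOp B C v, greenOp_mem_sobolev hab hd B C v⟩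
      =ᵐ[volume.restrict (Set.Icc a b)] stateVec a b B C v k := by
  have h := (weakDeriv_spec k ⟨greenOp B C v, greenOp_mem_sobolev hab hd B C v⟩).unique
    (greenOp_weakDeriv hab hd B C v k)
  exact (congrArg (fun w : L2 n a b => (w : ℝ → Vec n)) h).eventuallyEq.trans (MemLp.coeFn_toLp _)

/-- `∂_s^d 𝒯 v = v`. -/
theorem weakDeriv_last_greenOp {n d : ℕ} {a b : ℝ} (hab : a ≤ b) (hd : 0 < d)
    (B C : Matrix (Fin d × Fin n) (Fin d × Fin n) ℝ) (v : L2 n a b) :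
    weakDeriv (Fin.last d) ⟨greenOp B C v, greenOp_mem_sobolev hab hd B C v⟩ = v := by
  apply Lp.ext
  refine (weakDeriv_greenOp hab hd B C v (Fin.last d)).trans ?_
  rw [Fin.val_last, stateVec_top]

/-- `𝒯` maps into `D`. -/
theorem greenOp_mem {n d : ℕ} {a b : ℝ} (hab : a ≤ b) (hd : 0 < d)
    {B C : Matrix (Fin d × Fin n) (Fin d × Fin n) ℝ} (hK : PIECompatible a b B C) (v : L2 n a b) :
    greenOp B C v ∈ pieDomain a b B C := by
  refine ⟨greenOp_mem_sobolev hab hd B C v, fun j => stateVec a b B C v j,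
    fun j => ⟨stateVec_continuousOn hab B C v j.2, weakDeriv_greenOp hab hd B C v j.castSucc⟩,
    fun i => ?_⟩
  have hsum : ∀ (M : Matrix (Fin d × Fin n) (Fin d × Fin n) ℝ) (y : Fin d × Fin n → ℝ) (p : Fin n),
      ∑ j, ∑ q, M (i, p) (j, q) * y (j, q) = M.mulVec y (i, p) := by
    intro M y p
    rw [Matrix.mulVec, dotProduct, Fintype.sum_prod_type]
  have ha : ∀ (j : Fin d) (q : Fin n), stateVec a b B C v j a q = initData a b B C v (j, q) := by
    intro j q
    have e : stateVec a b B C v j a q = chain d a (fun l => initData a b B C v (l, q))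
      (fun θ => v θ q) j a := rfl
    rw [e, chain, if_pos j.2, Finset.sum_eq_single j]
    · simp [iterInt]
    · intro l _ hl
      by_cases h : j.val ≤ l.val
      · have : l.val - j.val ≠ 0 := by
          have : l.val ≠ j.val := fun h => hl (Fin.ext h)
          omega
        simp [h, this]
      · simp [h]
    · simp
  have hb : ∀ (j : Fin d) (q : Fin n), stateVec a b B C v j b q
      = (matQ n d (b - a)).mulVec (initData a b B C v) (j, q) + moment a b v (j, q) := by
    intro j q
    have e : stateVec a b B C v j b q = chain d a (fun l => initData a b B C v (l, q))
      (fun θ => v θ q) j b := rfl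
    rw [e, chain, if_pos j.2]
    congr 1
    rw [Matrix.mulVec, dotProduct, Fintype.sum_prod_type]
    refine Finset.sum_congr rfl fun l _ => ?_
    rw [Finset.sum_eq_single q]
    · by_cases h : j.val ≤ l.val
      · have h' : j ≤ l := h
        simp [matQ, h']
      · have h' : ¬ j ≤ l := h
        simp [matQ, h']
    · intro p _ hp
      simp [matQ, hp.symm]
    · simp
  ext p
  have e : (∑ j, (matCLM (block B i j) (stateVec a b B C v j a)
      + matCLM (block C i j) (stateVec a b B C v j b))) p
      = ∑ j, ((∑ q, B (i, p) (j, q) * stateVec a b B C v j a q)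
        + ∑ q, C (i, p) (j, q) * stateVec a b B C v j b q) := by
    rw [WithLp.ofLp_sum, Finset.sum_apply]
    rfl
  rw [e, Finset.sum_add_distrib]
  simp only [ha, hb]
  rw [hsum B, hsum C (fun x => (matQ n d (b - a)).mulVec (initData a b B C v) x + moment a b v x)]
  change (B.mulVec (initData a b B C v) + C.mulVec ((matQ n d (b - a)).mulVec
    (initData a b B C v) + moment a b v)) (i, p) = 0
  rw [Matrix.mulVec_add, Matrix.mulVec_mulVec, ← add_assoc, ← Matrix.add_mulVec]
  change ((matK a b B C).mulVec (initData a b B C v) + C.mulVec (moment a b v)) (i, p) = 0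
  rw [initData, Matrix.mulVec_neg, Matrix.mulVec_mulVec, ← Matrix.mul_assoc,
    Matrix.mul_nonsing_inv _ ((Matrix.isUnit_iff_isUnit_det _).1 hK), Matrix.one_mul,
    neg_add_cancel]
  rfl

theorem continuous_weakDeriv_greenOp {n d : ℕ} {a b : ℝ} (hab : a ≤ b) (hd : 0 < d)
    (B C : Matrix (Fin d × Fin n) (Fin d × Fin n) ℝ) (k : Fin (d + 1)) :
    Continuous fun v : L2 n a b =>
      weakDeriv k ⟨greenOp B C v, greenOp_mem_sobolev hab hd B C v⟩ := by
  let R : L2 n a b →ₗ[ℝ] L2 n a b :=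
    weakDeriv k ∘ₗ (greenOp B C).toLinearMap.codRestrict (sobolev n d a b)
      (greenOp_mem_sobolev hab hd B C)
  refine R.continuous_of_seq_closed_graph fun v x y hv hy => ?_
  have h := HasWeakDeriv.of_tendsto
    (fun m => weakDeriv_spec k ⟨greenOp B C (v m), greenOp_mem_sobolev hab hd B C (v m)⟩)
    (((greenOp B C).continuous.tendsto x).comp hv) hy
  exact h.unique (weakDeriv_spec k ⟨greenOp B C x, greenOp_mem_sobolev hab hd B C x⟩)

/-- The bounded operator `𝒜 = A ∘ 𝒯` on `L₂ⁿ[a,b]`. -/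
def pieOp {n d : ℕ} {a b : ℝ} (hab : a ≤ b) (hd : 0 < d)
    {B C : Matrix (Fin d × Fin n) (Fin d × Fin n) ℝ} (hK : PIECompatible a b B C)
    (A : Fin (d + 1) → Matrix (Fin n) (Fin n) ℝ[X]) : L2 n a b →L[ℝ] L2 n a b where
  toLinearMap := diffOp a b B C A ∘ₗ
    (greenOp B C).toLinearMap.codRestrict (pieDomain a b B C) (greenOp_mem hab hd hK)
  cont := by
    have e : ∀ v, (diffOp a b B C A ∘ₗ (greenOp B C).toLinearMap.codRestrict (pieDomain a b B C)
        (greenOp_mem hab hd hK)) v = ∑ k, mulOp (A k)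
          (weakDeriv k ⟨greenOp B C v, greenOp_mem_sobolev hab hd B C v⟩) := by
      intro v
      rw [LinearMap.comp_apply, diffOp, LinearMap.sum_apply]
      rfl
    change Continuous fun v => (diffOp a b B C A ∘ₗ
      (greenOp B C).toLinearMap.codRestrict (pieDomain a b B C) (greenOp_mem hab hd hK)) v
    simp only [e]
    exact continuous_finsetSum _ fun k _ =>
      (mulOp (A k)).continuous.comp (continuous_weakDeriv_greenOp hab hd B C k)

/-- Partial integral operators: `P₀(s) v(s) + ∫_a^s P₁(s,θ) v(θ) dθ + ∫_s^b P₂(s,θ) v(θ) dθ` with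
matrix-valued polynomials `P₀, P₁, P₂`. -/
def IsPIOperator {n : ℕ} {a b : ℝ} (P : L2 n a b →L[ℝ] L2 n a b) : Prop :=
  ∃ (P₀ : Matrix (Fin n) (Fin n) ℝ[X]) (P₁ P₂ : Matrix (Fin n) (Fin n) (MvPolynomial (Fin 2) ℝ)),
    ∀ v : L2 n a b, P v =ᵐ[volume.restrict (Set.Icc a b)] fun s =>
      matCLM (P₀.map (Polynomial.eval s)) (v s)
      + (∫ θ in a..s, matCLM (P₁.map (MvPolynomial.eval ![s, θ])) (v θ))
      + (∫ θ in s..b, matCLM (P₂.map (MvPolynomial.eval ![s, θ])) (v θ))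

/-- Strongly continuous semigroups of bounded operators. -/
structure IsC0Semigroup {H : Type*} [NormedAddCommGroup H] [NormedSpace ℝ H]
    (S : ℝ≥0 → H →L[ℝ] H) : Prop where
  zero : S 0 = 1
  add : ∀ t s, S (t + s) = S t * S s
  tendsto_zero : ∀ x, Tendsto (fun t => S t x) (𝓝[>] 0) (𝓝 x)

/-- `A : D → H` is the infinitesimal generator of `S`: `D` is exactly the set of all `x` for which
`t⁻¹ (S(t) x - x)` converges as `t → 0⁺`, and `A x` is the limit. -/
def IsGenerator {H : Type*} [NormedAddCommGroup H] [NormedSpace ℝ H] {D : Submodule ℝ H}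
    (A : D →ₗ[ℝ] H) (S : ℝ≥0 → H →L[ℝ] H) : Prop :=
  ∀ x y, (∃ hx : x ∈ D, A ⟨x, hx⟩ = y) ↔
    Tendsto (fun t : ℝ≥0 => (t : ℝ)⁻¹ • (S t x - x)) (𝓝[>] 0) (𝓝 y)

/-- `S` has growth rate `rate` and gain `M ≥ 1`. -/
def HasGrowthRate {H : Type*} [NormedAddCommGroup H] [NormedSpace ℝ H]
    (S : ℝ≥0 → H →L[ℝ] H) (rate M : ℝ) : Prop :=
  1 ≤ M ∧ ∀ t : ℝ≥0, ‖S t‖ ≤ M * Real.exp (rate * t)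

end PIE

end

/-! The operator inequalities are the hypotheses of the Lumer–Phillips theorem, pulled back along
`𝒯` and read in the inner product `[x, y] = ⟪P x, y⟫`. Since `ε₁² ‖x‖² ≤ [x, x] ≤ ‖P‖ ‖x‖²`, this
inner product is equivalent to the original one, and a contraction for it has operator norm at most
`√‖P‖ / ε₁`. As contractivity is kept in the form `[·,·]` and turned into a norm bound only at the
end, the gain does not accumulate in time.

On the side of the differential operator, `𝒯` is a bijection from `L₂ⁿ` onto `D`. It maps into `D`
and satisfies `∂_s^d 𝒯 v = v`, so it remains to see that `∂_s^d` is injective on `D`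
(`exists_eq_greenOp`). By the du Bois-Reymond lemma, a function with `∂_s^d u = 0` is a Taylor
polynomial with data `y` at `a`. The boundary conditions then say `K y = 0`, hence `y = 0`. With `x
= 𝒯 v` and `A x = 𝒜 v`, the second inequality becomes `[A x, x] ≤ ω [x, x]` on `D`. The third makes
`(λ𝒯 - 𝒜)(λ𝒯 - 𝒜)*` coercive, hence onto by Lax–Milgram, so `λ - A` maps `D` onto `L₂ⁿ`.

The abstract theorem (`exists_semigroup`) is proved for `A - ω`, which is dissipative for `[·,·]`,
by Yosida approximation. Dissipativity bounds the resolvent by `gain / μ`, a Neumann series carries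
it to a sequence `μ_k → ∞`, and the domain is dense automatically. The operators `B_k = μ_k² (μ_k -
A)⁻¹ - μ_k` are bounded, commuting and dissipative, and they converge strongly to `A` on `D`. The
exponentials `exp(t B_k)` are contractions for `[·,·]` and converge strongly to the semigroup, and
the factor `e^{ωt}` undoes the shift. -/

namespace LumerPhillips

open scoped InnerProductSpace

/-! ### Equivalent inner products, dissipativity, coercive operators -/

/-- `P` is symmetric and bounded below by `ε² > 0`, so that `⟪P x, y⟫` is an equivalent inner
product. -/
structure IsEquivForm {H : Type*} [NormedAddCommGroup H] [InnerProductSpace ℝ H]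
    (P : H →L[ℝ] H) (ε : ℝ) : Prop where
  pos : 0 < ε
  symm : ∀ x y, ⟪P x, y⟫_ℝ = ⟪P y, x⟫_ℝ
  coercive : ∀ x, ε ^ 2 * ‖x‖ ^ 2 ≤ ⟪P x, x⟫_ℝ

/-- `A` is dissipative with respect to the inner product `⟪P x, y⟫`. -/
def IsDissipative {H : Type*} [NormedAddCommGroup H] [InnerProductSpace ℝ H]
    (P : H →L[ℝ] H) {D : Submodule ℝ H} (A : D →ₗ[ℝ] H) : Prop :=
  ∀ x : D, ⟪P (A x), x⟫_ℝ ≤ 0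

/-- `R = (μ - A)⁻¹`. -/
structure IsResolvent {H : Type*} [NormedAddCommGroup H] [NormedSpace ℝ H]
    {D : Submodule ℝ H} (A : D →ₗ[ℝ] H) (μ : ℝ) (R : H →L[ℝ] H) : Prop where
  right : ∀ y, ∃ h : R y ∈ D, μ • R y - A ⟨R y, h⟩ = y
  left : ∀ x : D, R (μ • (x : H) - A x) = x

variable {H : Type*} [NormedAddCommGroup H] [InnerProductSpace ℝ H]

/-- The gain `√‖P‖ / ε`. -/
noncomputable def gain (P : H →L[ℝ] H) (ε : ℝ) : ℝ := Real.sqrt ‖P‖ / ε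

section Form

variable {P : H →L[ℝ] H} {ε : ℝ}

theorem form_le (P : H →L[ℝ] H) (x : H) : ⟪P x, x⟫_ℝ ≤ ‖P‖ * ‖x‖ ^ 2 :=
  calc ⟪P x, x⟫_ℝ ≤ ‖P x‖ * ‖x‖ := real_inner_le_norm _ _
    _ ≤ ‖P‖ * ‖x‖ * ‖x‖ := by gcongr; exact P.le_opNorm x
    _ = ‖P‖ * ‖x‖ ^ 2 := by ring

namespace IsEquivForm

variable (hP : IsEquivForm P ε)
include hP

theorem gain_nonneg : 0 ≤ gain P ε := div_nonneg (Real.sqrt_nonneg _) hP.pos.le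

theorem nonneg (x : H) : 0 ≤ ⟪P x, x⟫_ℝ :=
  (by positivity : (0 : ℝ) ≤ ε ^ 2 * ‖x‖ ^ 2).trans (hP.coercive x)

/-- Coercivity on the left and boundedness of `P` on the right turn an inequality between forms into
one between norms. This is the only source of the factor `√‖P‖ / ε`. -/
theorem norm_le {x y : H} {k : ℝ} (hk : 0 ≤ k) (h : ⟪P x, x⟫_ℝ ≤ k ^ 2 * ⟪P y, y⟫_ℝ) :
    ‖x‖ ≤ gain P ε * k * ‖y‖ := by
  have hε := hP.pos
  have h1 : ε ^ 2 * ‖x‖ ^ 2 ≤ k ^ 2 * (‖P‖ * ‖y‖ ^ 2) :=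
    (hP.coercive x).trans (h.trans (by gcongr; exact form_le P y))
  have h2 : (ε * ‖x‖) ^ 2 ≤ (Real.sqrt ‖P‖ * k * ‖y‖) ^ 2 := by
    rw [mul_pow, mul_pow, mul_pow, Real.sq_sqrt (norm_nonneg _)]
    linarith
  have h3 : ε * ‖x‖ ≤ Real.sqrt ‖P‖ * k * ‖y‖ := le_of_sq_le_sq h2 (by positivity)
  rw [gain, div_mul_eq_mul_div, div_mul_eq_mul_div, le_div_iff₀ hε]
  linarith

theorem norm_le_of_form_le {x y : H} (h : ⟪P x, x⟫_ℝ ≤ ⟪P y, y⟫_ℝ) :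
    ‖x‖ ≤ gain P ε * ‖y‖ := by
  simpa using hP.norm_le zero_le_one (x := x) (y := y) (by simpa using h)

theorem eq_zero_of_form_nonpos {x : H} (h : ⟪P x, x⟫_ℝ ≤ 0) : x = 0 := by
  have h1 := (hP.coercive x).trans h
  have h2 : 0 < ε ^ 2 := pow_pos hP.pos 2
  have h3 : ‖x‖ ^ 2 ≤ 0 := by nlinarith
  exact norm_eq_zero.1 (pow_eq_zero_iff two_ne_zero |>.1 (le_antisymm h3 (sq_nonneg _)))

theorem one_le_gain [Nontrivial H] : 1 ≤ gain P ε := by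
  obtain ⟨x, hx⟩ := exists_ne (0 : H)
  have h := hP.norm_le_of_form_le (le_refl ⟪P x, x⟫_ℝ)
  have : 0 < ‖x‖ := norm_pos_iff.2 hx
  nlinarith

end IsEquivForm

end Form

/-- A bounded operator that is bounded below as a form is onto. -/
theorem surjective_of_coercive [CompleteSpace H] (P : H →L[ℝ] H) {c : ℝ} (hc : 0 < c)
    (h : ∀ x, c * ‖x‖ ^ 2 ≤ ⟪P x, x⟫_ℝ) : Function.Surjective P := by
  -- Lax–Milgram for the bilinear form `⟪P u, w⟫`: the invertible operator representing it is `P`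
  -- itself.
  have hB : IsCoercive ((innerSL ℝ).comp P) :=
    ⟨c, hc, fun u => by
      have := h u
      simp only [ContinuousLinearMap.comp_apply, innerSL_apply_apply]
      linarith⟩
  intro y
  obtain ⟨x, hx⟩ := (hB.continuousLinearEquivOfBilin).surjective y
  refine ⟨x, ext_inner_right ℝ fun w => ?_⟩
  rw [← hx, hB.continuousLinearEquivOfBilin_apply]
  rfl

/-! ### Exponentials of bounded dissipative operators -/

section Exp

variable [CompleteSpace H] {P : H →L[ℝ] H} {ε : ℝ}

theorem hasDerivAt_exp_apply (B : H →L[ℝ] H) (x : H) (t : ℝ) :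
    HasDerivAt (fun t : ℝ => NormedSpace.exp (t • B) x) (NormedSpace.exp (t • B) (B x)) t :=
  (hasDerivAt_exp_smul_const B t).clm_apply (hasDerivAt_const t x) |>.congr_deriv (by simp)

theorem hasDerivAt_exp_apply' (B : H →L[ℝ] H) (x : H) (t : ℝ) :
    HasDerivAt (fun t : ℝ => NormedSpace.exp (t • B) x) (B (NormedSpace.exp (t • B) x)) t :=
  (hasDerivAt_exp_smul_const' B t).clm_apply (hasDerivAt_const t x) |>.congr_deriv (by simp)

/-- Along `u(t) = exp(tB) x` the derivative of `⟪P u, u⟫` is `2 ⟪P (B u), u⟫ ≤ 0`, by symmetry of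
`P`. -/
theorem form_exp_le (hP : IsEquivForm P ε) {B : H →L[ℝ] H} (hB : ∀ x, ⟪P (B x), x⟫_ℝ ≤ 0)
    (x : H) {t : ℝ} (ht : 0 ≤ t) :
    ⟪P (NormedSpace.exp (t • B) x), NormedSpace.exp (t • B) x⟫_ℝ ≤ ⟪P x, x⟫_ℝ := by
  have hd : ∀ t : ℝ, HasDerivAt
      (fun t : ℝ => ⟪P (NormedSpace.exp (t • B) x), NormedSpace.exp (t • B) x⟫_ℝ)
      (⟪P (NormedSpace.exp (t • B) x), B (NormedSpace.exp (t • B) x)⟫_ℝ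
        + ⟪P (B (NormedSpace.exp (t • B) x)), NormedSpace.exp (t • B) x⟫_ℝ) t := fun t =>
    (P.hasFDerivAt.comp_hasDerivAt t (hasDerivAt_exp_apply' B x t)).inner ℝ
      (hasDerivAt_exp_apply' B x t)
  have hanti : Antitone
      (fun t : ℝ => ⟪P (NormedSpace.exp (t • B) x), NormedSpace.exp (t • B) x⟫_ℝ) :=
    antitone_of_hasDerivAt_nonpos hd fun t => by
      have := hB (NormedSpace.exp (t • B) x)
      rw [hP.symm (NormedSpace.exp (t • B) x)]
      simp only [Pi.zero_apply]
      linarith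
  simpa using hanti ht

theorem norm_exp_apply_le (hP : IsEquivForm P ε) {B : H →L[ℝ] H}
    (hB : ∀ x, ⟪P (B x), x⟫_ℝ ≤ 0) (x : H) {t : ℝ} (ht : 0 ≤ t) :
    ‖NormedSpace.exp (t • B) x‖ ≤ gain P ε * ‖x‖ :=
  hP.norm_le_of_form_le (form_exp_le hP hB x ht)

/-- The path `s ↦ exp(sB) exp((t-s)B') x` joins `exp(tB') x` to `exp(tB) x`. As `B` and `B'`
commute, its derivative is `exp(sB) exp((t-s)B') (B x - B' x)`; each exponential costs one factor
`gain`. -/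
theorem norm_exp_sub_exp_le (hP : IsEquivForm P ε) {B B' : H →L[ℝ] H}
    (hB : ∀ x, ⟪P (B x), x⟫_ℝ ≤ 0) (hB' : ∀ x, ⟪P (B' x), x⟫_ℝ ≤ 0) (hc : Commute B B')
    (x : H) {t : ℝ} (ht : 0 ≤ t) :
    ‖NormedSpace.exp (t • B) x - NormedSpace.exp (t • B') x‖
      ≤ gain P ε * (gain P ε * ‖B x - B' x‖) * t := by
  have hd : ∀ s : ℝ, HasDerivAt
      (fun s : ℝ => NormedSpace.exp (s • B) (NormedSpace.exp ((t - s) • B') x))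
      (NormedSpace.exp (s • B) (NormedSpace.exp ((t - s) • B') (B x - B' x))) s := by
    intro s
    have h1 := hasDerivAt_exp_smul_const B s
    have h2 := (hasDerivAt_exp_apply B' x (t - s)).scomp s ((hasDerivAt_id s).const_sub t)
    refine (h1.clm_apply h2).congr_deriv ?_
    have hc' : Commute B (NormedSpace.exp ((t - s) • B')) :=
      (hc.smul_right (t - s)).exp_right
    have e : B (NormedSpace.exp ((t - s) • B') x) = NormedSpace.exp ((t - s) • B') (B x) :=
      congrArg (fun L : H →L[ℝ] H => L x) hc'.eq
    simp only [mul_apply_eq_comp, Function.comp_apply, e, map_sub, neg_smul,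
      one_smul, map_neg]
    abel
  have h := norm_image_sub_le_of_norm_deriv_le_segment'
    (f := fun s : ℝ => NormedSpace.exp (s • B) (NormedSpace.exp ((t - s) • B') x))
    (C := gain P ε * (gain P ε * ‖B x - B' x‖)) (a := 0) (b := t)
    (fun s _ => (hd s).hasDerivWithinAt) (fun s hs => by
      refine (norm_exp_apply_le hP hB _ hs.1).trans ?_
      have := hP.gain_nonneg
      gcongr
      exact norm_exp_apply_le hP hB' _ (sub_nonneg.2 hs.2.le)) t ⟨ht, le_rfl⟩
  simpa using h

theorem norm_exp_sub_le (hP : IsEquivForm P ε) {B : H →L[ℝ] H}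
    (hB : ∀ x, ⟪P (B x), x⟫_ℝ ≤ 0) (x : H) {t : ℝ} (ht : 0 ≤ t) :
    ‖NormedSpace.exp (t • B) x - x‖ ≤ gain P ε * ‖B x‖ * t := by
  have h := norm_image_sub_le_of_norm_deriv_le_segment'
    (f := fun s : ℝ => NormedSpace.exp (s • B) x)
    (C := gain P ε * ‖B x‖) (a := 0) (b := t)
    (fun s _ => (hasDerivAt_exp_apply B x s).hasDerivWithinAt)
    (fun s hs => norm_exp_apply_le hP hB _ hs.1) t ⟨ht, le_rfl⟩
  simpa using h

/-- Second order estimate at `0`, with an approximation `z` of `B x`. -/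
theorem norm_exp_sub_sub_le (hP : IsEquivForm P ε) {B : H →L[ℝ] H}
    (hB : ∀ x, ⟪P (B x), x⟫_ℝ ≤ 0) (x z : H) {t : ℝ} (ht : 0 ≤ t) :
    ‖NormedSpace.exp (t • B) x - x - t • B x‖
      ≤ (gain P ε * ‖B z‖ * t + (gain P ε + 1) * ‖B x - z‖) * t := by
  have hd : ∀ s : ℝ, HasDerivAt (fun s : ℝ => NormedSpace.exp (s • B) x - s • B x)
      (NormedSpace.exp (s • B) (B x) - B x) s := fun s =>
    (hasDerivAt_exp_apply B x s).sub (((hasDerivAt_id s).smul_const (B x)).congr_deriv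
      (one_smul _ _))
  have hg := hP.gain_nonneg
  have h := norm_image_sub_le_of_norm_deriv_le_segment'
    (f := fun s : ℝ => NormedSpace.exp (s • B) x - s • B x)
    (C := gain P ε * ‖B z‖ * t + (gain P ε + 1) * ‖B x - z‖) (a := 0) (b := t)
    (fun s _ => (hd s).hasDerivWithinAt) (fun s hs => by
      -- A bound through `B (B x)` would not be uniform along the Yosida approximations when `A x`
      -- lies outside the domain. Replacing `B x` by a nearby `z` leaves `B z`, which stays bounded
      -- for `z` in the domain, at the price of a multiple of `‖B x - z‖`.
      have e : NormedSpace.exp (s • B) (B x) - B x = (NormedSpace.exp (s • B) z - z)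
          + (NormedSpace.exp (s • B) (B x - z) - (B x - z)) := by
        rw [map_sub]; abel
      rw [e]
      refine (norm_add_le _ _).trans (add_le_add ?_ ?_)
      · refine (norm_exp_sub_le hP hB z hs.1).trans ?_
        gcongr
        exact hs.2.le
      · refine (norm_sub_le _ _).trans ?_
        have := norm_exp_apply_le hP hB (B x - z) hs.1
        linarith) t ⟨ht, le_rfl⟩
  have e : NormedSpace.exp (t • B) x - x - t • B x = NormedSpace.exp (t • B) x - t • B x - x := by
    abel
  rw [e]
  simpa using h

end Exp

/-! ### Resolvents of dissipative operators and Yosida approximations -/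

section Resolvent

variable {P : H →L[ℝ] H} {ε : ℝ} {D : Submodule ℝ H} {A : D →ₗ[ℝ] H}

/-- Expanding the form at `μ x - A x` gives `μ² [x, x] - 2μ [A x, x] + [A x, A x]`, and the last two
terms are nonnegative. -/
theorem form_resolvent_le (hP : IsEquivForm P ε) (hA : IsDissipative P A) {μ : ℝ} (hμ : 0 < μ)
    (x : D) : ⟪P (x : H), x⟫_ℝ ≤ μ⁻¹ ^ 2 * ⟪P (μ • (x : H) - A x), μ • (x : H) - A x⟫_ℝ := by
  have h1 := hA x
  have h2 := hP.nonneg (A x)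
  have h3 := hP.symm (x : H) (A x)
  rw [inv_pow, inv_mul_eq_div, le_div_iff₀ (by positivity)]
  simp only [map_sub, map_smul, inner_sub_left, inner_sub_right, inner_smul_left,
    inner_smul_right, RCLike.conj_to_real]
  nlinarith

theorem norm_le_of_resolvent (hP : IsEquivForm P ε) (hA : IsDissipative P A) {μ : ℝ} (hμ : 0 < μ)
    (x : D) : ‖(x : H)‖ ≤ gain P ε * μ⁻¹ * ‖μ • (x : H) - A x‖ :=
  hP.norm_le (by positivity) (form_resolvent_le hP hA hμ x)

theorem exists_isResolvent (hP : IsEquivForm P ε) (hA : IsDissipative P A) {μ : ℝ} (hμ : 0 < μ)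
    (hs : ∀ y, ∃ x : D, μ • (x : H) - A x = y) : ∃ R, IsResolvent A μ R := by
  let L : D →ₗ[ℝ] H := μ • D.subtype - A
  have hL : ∀ x, L x = μ • (x : H) - A x := fun x => rfl
  have hinj : Function.Injective L := by
    refine (injective_iff_map_eq_zero L).2 fun x hx => ?_
    have h := norm_le_of_resolvent hP hA hμ x
    rw [← hL, hx, norm_zero, mul_zero] at h
    exact Subtype.ext (norm_le_zero_iff.1 h)
  let e := LinearEquiv.ofBijective L ⟨hinj, fun y => (hs y).imp fun x hx => hx⟩
  have he : ∀ y, L (e.symm y) = y := fun y => e.apply_symm_apply y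
  refine ⟨(D.subtype ∘ₗ e.symm.toLinearMap).mkContinuous (gain P ε * μ⁻¹) fun y => ?_, ?_, ?_⟩
  · have h := norm_le_of_resolvent hP hA hμ (e.symm y)
    rw [← hL, he] at h
    exact h
  · exact fun y => ⟨(e.symm y).2, he y⟩
  · exact fun x => congrArg Subtype.val (e.symm_apply_apply x)

theorem IsResolvent.exists_eq {μ : ℝ} {R : H →L[ℝ] H} (hR : IsResolvent A μ R) (y : H) :
    ∃ x : D, R y = x ∧ μ • (x : H) - A x = y := by
  obtain ⟨h, e⟩ := hR.right y
  exact ⟨⟨R y, h⟩, rfl, e⟩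

theorem IsResolvent.norm_apply_le (hP : IsEquivForm P ε) (hA : IsDissipative P A) {μ : ℝ}
    (hμ : 0 < μ) {R : H →L[ℝ] H} (hR : IsResolvent A μ R) (y : H) :
    ‖R y‖ ≤ gain P ε * μ⁻¹ * ‖y‖ := by
  obtain ⟨h, e⟩ := hR.right y
  have := norm_le_of_resolvent hP hA hμ ⟨R y, h⟩
  simpa only [e] using this

/-- From `μ(1+δ) - A = (1 + μδ R)(μ - A)` on `D` and `‖μδ R‖ ≤ gain · δ < 1`, a Neumann series
inverts the first factor. The admissible `δ` does not depend on `μ`, so the step can be iterated to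
reach arbitrarily large parameters. -/
theorem IsResolvent.step [CompleteSpace H] (hP : IsEquivForm P ε) (hA : IsDissipative P A) {μ δ : ℝ}
    (hμ : 0 < μ) (hδ : 0 < δ) (hδ' : gain P ε * δ < 1) {R : H →L[ℝ] H}
    (hR : IsResolvent A μ R) : ∃ R', IsResolvent A (μ * (1 + δ)) R' := by
  have hg := hP.gain_nonneg
  refine exists_isResolvent hP hA (by positivity) fun y => ?_
  have hn : ‖-((μ * δ) • R)‖ < 1 := by
    rw [norm_neg]
    refine (ContinuousLinearMap.opNorm_le_bound _ (by positivity) fun y => ?_).trans_lt hδ'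
    rw [smul_apply, norm_smul, Real.norm_of_nonneg (by positivity)]
    calc μ * δ * ‖R y‖ ≤ μ * δ * (gain P ε * μ⁻¹ * ‖y‖) := by
          gcongr; exact hR.norm_apply_le hP hA hμ y
      _ = gain P ε * δ * ‖y‖ := by field_simp
  obtain ⟨u, hu⟩ := isUnit_one_sub_of_norm_lt_one hn
  -- The solution is `R u⁻¹ y` with `u = 1 + μδ R`.
  obtain ⟨h, e⟩ := hR.right ((↑u⁻¹ : H →L[ℝ] H) y)
  refine ⟨⟨R ((↑u⁻¹ : H →L[ℝ] H) y), h⟩, ?_⟩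
  have h1 : (u : H →L[ℝ] H) ((↑u⁻¹ : H →L[ℝ] H) y) = y := by
    rw [← mul_apply_eq_comp, Units.mul_inv, one_apply_eq_self]
  rw [hu] at h1
  simp only [sub_neg_eq_add, add_apply, one_apply_eq_self,
    smul_apply] at h1
  rw [mul_add, mul_one, add_smul, add_sub_right_comm]
  simp only
  rw [e, h1]

/-- The resolvent identity: write `y = (ν - A) R' y = (μ - A) R' y + (ν - μ) R' y` and apply `R`. -/
theorem IsResolvent.sub_eq {μ ν : ℝ} {R R' : H →L[ℝ] H} (hR : IsResolvent A μ R)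
    (hR' : IsResolvent A ν R') (y : H) : R y = R' y + (ν - μ) • R (R' y) := by
  obtain ⟨h, e⟩ := hR'.right y
  have h1 := hR.left ⟨R' y, h⟩
  have e2 : y = (μ • R' y - A ⟨R' y, h⟩) + (ν - μ) • R' y := by
    conv_lhs => rw [← e]
    rw [sub_smul]; abel
  conv_lhs => rw [e2, map_add, h1, map_smul]

/-- The resolvent identity and its mirror image express `R - R'` as both `(ν - μ) R R'` and `(ν - μ)
R' R`. For equal parameters the resolvents coincide. -/
theorem IsResolvent.commute {μ ν : ℝ} {R R' : H →L[ℝ] H} (hR : IsResolvent A μ R)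
    (hR' : IsResolvent A ν R') : Commute R R' := by
  ext y
  simp only [mul_apply_eq_comp]
  by_cases hμν : μ = ν
  · subst hμν
    have : R = R' := by
      ext z
      have := hR.sub_eq hR' z
      simpa using this
    rw [this]
  · have h1 := hR.sub_eq hR' y
    have h2 := hR'.sub_eq hR y
    have h3 : (ν - μ) • (R (R' y) - R' (R y)) = 0 := by
      have : (ν - μ) • R (R' y) = -((μ - ν) • R' (R y)) := by
        have h4 : R y - R' y = (ν - μ) • R (R' y) := sub_eq_of_eq_add' h1
        have h5 : R' y - R y = (μ - ν) • R' (R y) := sub_eq_of_eq_add' h2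
        rw [← h4, ← h5]; abel
      rw [smul_sub, this, ← neg_smul, neg_sub, sub_self]
    have h4 := (smul_eq_zero.1 h3).resolve_left (sub_ne_zero.2 (Ne.symm hμν))
    exact sub_eq_zero.1 h4

/-- A vector orthogonal to `D` has the form `P (μ x - A x)` with `x ∈ D`, because `P` and `μ - A`
are onto. Pairing it with `x` gives `μ [x, x] = [A x, x] ≤ 0`, so `x = 0`. -/
theorem dense_domain [CompleteSpace H] (hP : IsEquivForm P ε) (hA : IsDissipative P A) {μ : ℝ}
    (hμ : 0 < μ) {R : H →L[ℝ] H} (hR : IsResolvent A μ R) : Dense (D : Set H) := by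
  rw [Submodule.dense_iff_topologicalClosure_eq_top, Submodule.topologicalClosure_eq_top_iff,
    Submodule.eq_bot_iff]
  intro w hw
  obtain ⟨z, rfl⟩ := surjective_of_coercive P (pow_pos hP.pos 2) hP.coercive w
  obtain ⟨x, -, rfl⟩ := hR.exists_eq z
  have h0 := (Submodule.mem_orthogonal' D _).1 hw x x.2
  have h1 := hA x
  simp only [map_sub, map_smul, inner_sub_left, inner_smul_left, RCLike.conj_to_real] at h0
  have h3 : (x : H) = 0 := by
    apply hP.eq_zero_of_form_nonpos
    nlinarith
  have h4 : x = 0 := Subtype.ext h3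
  simp [h4]

/-- The Yosida approximation `μ² (μ - A)⁻¹ - μ`. -/
noncomputable def yosida (μ : ℝ) (R : H →L[ℝ] H) : H →L[ℝ] H := μ ^ 2 • R - μ • 1

theorem yosida_apply (μ : ℝ) (R : H →L[ℝ] H) (y : H) :
    yosida μ R y = μ ^ 2 • R y - μ • y := rfl

/-- With `x = R y` the approximation sends `y = μ x - A x` to `μ A x`, so the form equals `μ (μ [A
x, x] - [A x, A x])`. -/
theorem IsResolvent.form_yosida_le (hP : IsEquivForm P ε) (hA : IsDissipative P A) {μ : ℝ}
    (hμ : 0 < μ) {R : H →L[ℝ] H} (hR : IsResolvent A μ R) (y : H) :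
    ⟪P (yosida μ R y), y⟫_ℝ ≤ 0 := by
  obtain ⟨x, hx, e⟩ := hR.exists_eq y
  have h1 := hA x
  have h2 := hP.nonneg (A x)
  have e1 : yosida μ R y = μ • A x := by
    rw [yosida_apply, hx, ← e, smul_sub, smul_smul, pow_two]
    abel
  have e2 : ⟪P (yosida μ R y), y⟫_ℝ
      = μ * (μ * ⟪P (A x), x⟫_ℝ - ⟪P (A x), A x⟫_ℝ) := by
    rw [e1, ← e]
    simp only [map_smul, inner_sub_right, inner_smul_left, inner_smul_right, RCLike.conj_to_real]
    ring
  rw [e2]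
  refine mul_nonpos_of_nonneg_of_nonpos hμ.le ?_
  nlinarith

/-- This reduces convergence of the approximations on `D` to `μ R → 1` strongly as `μ → ∞`. -/
theorem IsResolvent.yosida_eq {μ : ℝ} {R : H →L[ℝ] H} (hR : IsResolvent A μ R) (x : D) :
    yosida μ R x = μ • R (A x) := by
  have h := hR.left x
  rw [map_sub, map_smul] at h
  have h' : R (A x) = μ • R (x : H) - x := (sub_eq_iff_eq_add.1 h).symm ▸ by abel
  rw [yosida_apply, h', smul_sub, smul_smul, pow_two]

theorem commute_yosida {μ ν : ℝ} {R R' : H →L[ℝ] H} (h : Commute R R') :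
    Commute (yosida μ R) (yosida ν R') := by
  unfold yosida
  refine Commute.sub_left (Commute.sub_right ?_ ?_) (Commute.sub_right ?_ ?_)
  · exact (h.smul_left _).smul_right _
  · exact ((Commute.one_right _).smul_left _).smul_right _
  · exact ((Commute.one_left _).smul_left _).smul_right _
  · exact ((Commute.one_left _).smul_left _).smul_right _

end Resolvent

/-! ### Strong limits from a dense set -/

/-- Strong convergence of uniformly bounded operators extends from a dense set. -/
theorem tendsto_of_dense {ι : Type*} {l : Filter ι} {s : Set H} (hs : Dense s)
    {F : ι → H →L[ℝ] H} {G : H →L[ℝ] H} {c : ℝ} (hF : ∀ᶠ i in l, ∀ x, ‖F i x‖ ≤ c * ‖x‖)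
    (h : ∀ x ∈ s, Tendsto (fun i => F i x) l (𝓝 (G x))) (x : H) :
    Tendsto (fun i => F i x) l (𝓝 (G x)) := by
  rw [Metric.tendsto_nhds]
  intro r hr
  set K := |c| + ‖G‖ + 1 with hK
  have hK0 : 0 < K := by positivity
  obtain ⟨z, hz, hxz⟩ := Metric.dense_iff.1 hs x (r / (2 * K)) (by positivity)
  rw [Metric.mem_ball, dist_eq_norm] at hz
  filter_upwards [hF, (Metric.tendsto_nhds.1 (h z hxz)) (r / 2) (by positivity)] with i h1 h2
  rw [dist_eq_norm] at h2 ⊢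
  have e : F i x - G x = (F i z - G z) - F i (z - x) + G (z - x) := by
    simp only [map_sub]; abel
  have h3 : ‖F i (z - x)‖ ≤ |c| * ‖z - x‖ := (h1 _).trans (by gcongr; exact le_abs_self c)
  have h4 := G.le_opNorm (z - x)
  have h5 : (|c| + ‖G‖) * ‖z - x‖ ≤ r / 2 := by
    have : K * ‖z - x‖ ≤ K * (r / (2 * K)) := by gcongr
    have e : K * (r / (2 * K)) = r / 2 := by field_simp
    have := norm_nonneg (z - x)
    nlinarith
  rw [e]
  have h6 := norm_add_le (F i z - G z - F i (z - x)) (G (z - x))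
  have h7 := norm_sub_le (F i z - G z) (F i (z - x))
  linarith

theorem cauchySeq_of_dense {s : Set H} (hs : Dense s) {F : ℕ → H →L[ℝ] H} {c : ℝ} (hc : 0 ≤ c)
    (hF : ∀ i x, ‖F i x‖ ≤ c * ‖x‖) (h : ∀ x ∈ s, CauchySeq fun i => F i x) (x : H) :
    CauchySeq fun i => F i x := by
  rw [Metric.cauchySeq_iff]
  intro r hr
  obtain ⟨z, hz, hxz⟩ := Metric.dense_iff.1 hs x (r / (4 * (c + 1))) (by positivity)
  rw [Metric.mem_ball, dist_eq_norm] at hz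
  obtain ⟨N, hN⟩ := Metric.cauchySeq_iff.1 (h z hxz) (r / 2) (by positivity)
  refine ⟨N, fun m hm k hk => ?_⟩
  have h1 := hN m hm k hk
  rw [dist_eq_norm] at h1 ⊢
  have e : F m x - F k x = (F m z - F k z) - F m (z - x) + F k (z - x) := by
    simp only [map_sub]; abel
  have h2 := hF m (z - x)
  have h3 := hF k (z - x)
  have h4 : c * ‖z - x‖ ≤ r / 4 := by
    have h5 : (c + 1) * ‖z - x‖ ≤ (c + 1) * (r / (4 * (c + 1))) := by gcongr
    have e : (c + 1) * (r / (4 * (c + 1))) = r / 4 := by field_simp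
    have := norm_nonneg (z - x)
    nlinarith
  rw [e]
  have h6 := norm_add_le (F m z - F k z - F m (z - x)) (F k (z - x))
  have h7 := norm_sub_le (F m z - F k z) (F m (z - x))
  linarith

/-! ### The semigroup as limit of the Yosida exponentials -/

section Limit

variable [CompleteSpace H] {P : H →L[ℝ] H} {ε : ℝ} {D : Submodule ℝ H} {A : D →ₗ[ℝ] H}

/-- Bounded, commuting, dissipative operators `B k` that converge strongly to `A` on its dense
domain `D`. -/
structure IsYosidaSeq (P : H →L[ℝ] H) (A : D →ₗ[ℝ] H) (B : ℕ → H →L[ℝ] H) : Prop where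
  dense : Dense (D : Set H)
  dissipative : ∀ k x, ⟪P (B k x), x⟫_ℝ ≤ 0
  commute : ∀ k l, Commute (B k) (B l)
  tendsto : ∀ x : D, Tendsto (fun k => B k x) atTop (𝓝 (A x))

theorem exists_isYosidaSeq (hP : IsEquivForm P ε) (hA : IsDissipative P A) {μ : ℝ} (hμ : 0 < μ)
    {R : H →L[ℝ] H} (hR : IsResolvent A μ R) : ∃ B, IsYosidaSeq P A B := by
  have hg := hP.gain_nonneg
  -- This choice makes `gain · δ < 1`, so that the parameters `μ (1 + δ)^k`, which tend to infinity,
  -- are reached by Neumann steps.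
  set δ : ℝ := 1 / (gain P ε + 1) with hδ
  have hδ0 : 0 < δ := by positivity
  have hδ1 : gain P ε * δ < 1 := by
    rw [hδ, mul_one_div, div_lt_one (by positivity)]
    linarith
  have hex : ∀ k : ℕ, ∃ R', IsResolvent A (μ * (1 + δ) ^ k) R' := by
    intro k
    induction k with
    | zero => exact ⟨R, by simpa using hR⟩
    | succ k ih =>
      obtain ⟨R', hR'⟩ := ih
      rw [pow_succ, ← mul_assoc]
      exact hR'.step hP hA (by positivity) hδ0 hδ1
  choose Q hQ using hex
  have hpos : ∀ k : ℕ, 0 < μ * (1 + δ) ^ k := fun k => by positivity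
  have hlim : Tendsto (fun k : ℕ => (μ * (1 + δ) ^ k)⁻¹) atTop (𝓝 0) :=
    ((tendsto_pow_atTop_atTop_of_one_lt (by linarith : 1 < 1 + δ)).const_mul_atTop
      hμ).inv_tendsto_atTop
  have hdense := dense_domain hP hA hμ hR
  refine ⟨fun k => yosida (μ * (1 + δ) ^ k) (Q k), hdense,
    fun k x => (hQ k).form_yosida_le hP hA (hpos k) x,
    fun k l => commute_yosida ((hQ k).commute (hQ l)), fun x => ?_⟩
  -- Strong convergence `μ_k R_k → 1`: these operators are bounded by `gain`, and on `D` one has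
  -- `μ_k R_k z - z = R_k (A z)`, of norm at most `gain · μ_k⁻¹ · ‖A z‖`. Density does the rest.
  have happ : ∀ z, Tendsto (fun k => ((μ * (1 + δ) ^ k) • Q k) z) atTop
      (𝓝 ((1 : H →L[ℝ] H) z)) := by
    refine tendsto_of_dense hdense (c := gain P ε) (Eventually.of_forall fun k z => ?_)
      fun z hz => ?_
    · rw [smul_apply, norm_smul, Real.norm_of_nonneg (hpos k).le]
      calc μ * (1 + δ) ^ k * ‖Q k z‖
          ≤ μ * (1 + δ) ^ k * (gain P ε * (μ * (1 + δ) ^ k)⁻¹ * ‖z‖) :=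
            mul_le_mul_of_nonneg_left ((hQ k).norm_apply_le hP hA (hpos k) z) (hpos k).le
        _ = gain P ε * ‖z‖ := by
            have := (hpos k).ne'
            generalize μ * (1 + δ) ^ k = m at this
            field_simp
    · rw [tendsto_iff_norm_sub_tendsto_zero]
      refine squeeze_zero (fun _ => norm_nonneg _) (fun k => ?_)
        (by simpa only [mul_zero, zero_mul] using
          (hlim.const_mul (gain P ε)).mul_const ‖A ⟨z, hz⟩‖)
      have h := (hQ k).left ⟨z, hz⟩
      rw [map_sub, map_smul] at h
      have e : ((μ * (1 + δ) ^ k) • Q k) z - (1 : H →L[ℝ] H) z = Q k (A ⟨z, hz⟩) := by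
        rw [smul_apply, one_apply_eq_self]
        nth_rewrite 2 [show z = ((⟨z, hz⟩ : D) : H) from rfl]
        rw [← h]
        abel
      rw [e]
      exact (hQ k).norm_apply_le hP hA (hpos k) _
  refine (happ (A x)).congr fun k => ?_
  rw [(hQ k).yosida_eq]
  rfl

variable {B : ℕ → H →L[ℝ] H}

/-- On `D` the sequence `B k x` is Cauchy, hence by `norm_exp_sub_exp_le` so are the exponentials;
the uniform bound `gain` extends this to all of `H`. -/
theorem IsYosidaSeq.exists_limit (hP : IsEquivForm P ε) (hB : IsYosidaSeq P A B) :
    ∃ S : ℝ≥0 → H →L[ℝ] H, ∀ (t : ℝ≥0) x,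
      Tendsto (fun k => NormedSpace.exp ((t : ℝ) • B k) x) atTop (𝓝 (S t x)) := by
  have hg := hP.gain_nonneg
  have hlim : ∀ (t : ℝ≥0) (x : H),
      ∃ y, Tendsto (fun k => NormedSpace.exp ((t : ℝ) • B k) x) atTop (𝓝 y) := by
    intro t x
    refine cauchySeq_tendsto_of_complete (cauchySeq_of_dense hB.dense hg
      (fun k x => norm_exp_apply_le hP (hB.dissipative k) x t.2) (fun x hx => ?_) x)
    rw [Metric.cauchySeq_iff]
    intro r hr
    obtain ⟨N, hN⟩ := Metric.cauchySeq_iff.1 (hB.tendsto ⟨x, hx⟩).cauchySeq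
      -- The denominator is the constant of `norm_exp_sub_exp_le`, with `1` added to keep it
      -- positive when `t = 0`.
      (r / (gain P ε * gain P ε * t + 1)) (by positivity)
    refine ⟨N, fun k hk l hl => ?_⟩
    have h1 := hN k hk l hl
    rw [dist_eq_norm] at h1 ⊢
    refine (norm_exp_sub_exp_le hP (hB.dissipative k) (hB.dissipative l) (hB.commute k l) x
      t.2).trans_lt ?_
    rw [lt_div_iff₀ (by positivity)] at h1
    have := norm_nonneg (B k x - B l x)
    simp only at h1
    change _ * (t : ℝ) < _
    nlinarith
  choose f hf using fun t => fun x => hlim t x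
  exact ⟨fun t => continuousLinearMapOfTendsto (fun k => NormedSpace.exp ((t : ℝ) • B k))
    (tendsto_pi_nhds.2 (hf t)), fun t x => hf t x⟩

variable {S : ℝ≥0 → H →L[ℝ] H}

section

variable (hP : IsEquivForm P ε) (hB : IsYosidaSeq P A B)
  (hS : ∀ (t : ℝ≥0) x, Tendsto (fun k => NormedSpace.exp ((t : ℝ) • B k) x) atTop (𝓝 (S t x)))
include hP hB hS

theorem IsYosidaSeq.form_le (t : ℝ≥0) (x : H) : ⟪P (S t x), S t x⟫_ℝ ≤ ⟪P x, x⟫_ℝ := by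
  have h1 : Tendsto (fun k => ⟪P (NormedSpace.exp ((t : ℝ) • B k) x),
      NormedSpace.exp ((t : ℝ) • B k) x⟫_ℝ) atTop (𝓝 ⟪P (S t x), S t x⟫_ℝ) :=
    ((P.continuous.tendsto _).comp (hS t x)).inner (hS t x)
  exact le_of_tendsto' h1 fun k => form_exp_le hP (hB.dissipative k) x t.2

theorem IsYosidaSeq.norm_le (t : ℝ≥0) (x : H) : ‖S t x‖ ≤ gain P ε * ‖x‖ :=
  hP.norm_le_of_form_le (hB.form_le hP hS t x)

theorem IsYosidaSeq.norm_sub_le (t : ℝ≥0) (x : D) : ‖S t x - x‖ ≤ gain P ε * ‖A x‖ * t :=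
  le_of_tendsto_of_tendsto' ((hS t x).sub_const _).norm
    (((hB.tendsto x).norm.const_mul _).mul_const _)
    fun k => norm_exp_sub_le hP (hB.dissipative k) x t.2

/-- The vector `z` must lie in `D` so that `B k z` converges and the estimate for the exponentials
passes to the limit. -/
theorem IsYosidaSeq.norm_sub_sub_le (t : ℝ≥0) (x z : D) :
    ‖S t x - x - (t : ℝ) • A x‖
      ≤ (gain P ε * ‖A z‖ * t + (gain P ε + 1) * ‖A x - z‖) * t :=
  le_of_tendsto_of_tendsto' (((hS t x).sub_const _).sub ((hB.tendsto x).const_smul _)).norm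
    ((((hB.tendsto z).norm.const_mul _).mul_const _).add
      (((hB.tendsto x).sub_const _).norm.const_mul _) |>.mul_const _)
    fun k => norm_exp_sub_sub_le hP (hB.dissipative k) x z t.2

theorem IsYosidaSeq.isC0Semigroup : PIE.IsC0Semigroup S where
  zero := by
    ext x
    refine tendsto_nhds_unique (hS 0 x) ?_
    simp
  add t s := by
    ext x
    -- Products of uniformly bounded, strongly convergent operators converge strongly: the inner
    -- error is multiplied by at most `gain`.
    have h1 : Tendsto (fun k => NormedSpace.exp ((t : ℝ) • B k) (NormedSpace.exp ((s : ℝ) • B k) x))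
        atTop (𝓝 (S t (S s x))) := by
      rw [tendsto_iff_norm_sub_tendsto_zero]
      have h2 := ((tendsto_iff_norm_sub_tendsto_zero.1 (hS s x)).const_mul (gain P ε)).add
        (tendsto_iff_norm_sub_tendsto_zero.1 (hS t (S s x)))
      simp only [mul_zero, add_zero] at h2
      refine squeeze_zero (fun _ => norm_nonneg _) (fun k => ?_) h2
      refine le_trans (le_of_eq ?_) ((norm_add_le _ _).trans (add_le_add_left
        (norm_exp_apply_le hP (hB.dissipative k) (NormedSpace.exp ((s : ℝ) • B k) x - S s x)
          t.coe_nonneg) _))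
      rw [map_sub, sub_add_sub_cancel]
    refine tendsto_nhds_unique (hS (t + s) x) (h1.congr fun k => ?_)
    let := NormedAlgebra.restrictScalars ℚ ℝ (H →L[ℝ] H)
    rw [NNReal.coe_add, add_smul, NormedSpace.exp_add_of_commute
      (((Commute.refl (B k)).smul_left _).smul_right _)]
    rfl
  tendsto_zero := by
    have h0 : Tendsto (fun t : ℝ≥0 => (t : ℝ)) (𝓝[>] 0) (𝓝 0) :=
      (NNReal.continuous_coe.tendsto' 0 0 rfl).mono_left nhdsWithin_le_nhds
    refine tendsto_of_dense (G := 1) hB.dense (c := gain P ε)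
      (Eventually.of_forall fun t x => hB.norm_le hP hS t x) fun x hx => ?_
    rw [tendsto_iff_norm_sub_tendsto_zero]
    exact squeeze_zero (fun _ => norm_nonneg _) (fun t => hB.norm_sub_le hP hS t ⟨x, hx⟩)
      (by simpa using h0.const_mul (gain P ε * ‖A ⟨x, hx⟩‖))

theorem IsYosidaSeq.tendsto_generator (x : D) :
    Tendsto (fun t : ℝ≥0 => (t : ℝ)⁻¹ • (S t x - x)) (𝓝[>] 0) (𝓝 (A x)) := by
  have hg := hP.gain_nonneg
  rw [Metric.tendsto_nhds]
  intro r hr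
  -- The radius makes `(gain + 1) ‖A x - z‖ < r / 2`. Once `z` is fixed, the term `gain · ‖A z‖ · t`
  -- falls below `r / 2` for small `t`.
  obtain ⟨z, hz, hzD⟩ := Metric.dense_iff.1 hB.dense (A x) (r / (2 * (gain P ε + 1)))
    (by positivity)
  rw [Metric.mem_ball, dist_eq_norm, norm_sub_rev, lt_div_iff₀ (by positivity)] at hz
  have h0 : Tendsto (fun t : ℝ≥0 => gain P ε * ‖A ⟨z, hzD⟩‖ * (t : ℝ)) (𝓝[>] 0) (𝓝 0) := by
    have : Tendsto (fun t : ℝ≥0 => (t : ℝ)) (𝓝[>] 0) (𝓝 0) :=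
      (NNReal.continuous_coe.tendsto' 0 0 rfl).mono_left nhdsWithin_le_nhds
    simpa using this.const_mul (gain P ε * ‖A ⟨z, hzD⟩‖)
  filter_upwards [h0.eventually (gt_mem_nhds (half_pos hr)), self_mem_nhdsWithin] with t h1 h2
  have ht : (0 : ℝ) < t := NNReal.coe_pos.2 h2
  have h3 := hB.norm_sub_sub_le hP hS t x ⟨z, hzD⟩
  have e : (t : ℝ)⁻¹ • (S t x - x) - A x = (t : ℝ)⁻¹ • (S t x - x - (t : ℝ) • A x) := by
    rw [smul_sub _ (S t (x : H) - x), smul_smul, inv_mul_cancel₀ ht.ne', one_smul]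
  rw [dist_eq_norm, e, norm_smul, norm_inv, Real.norm_of_nonneg ht.le, inv_mul_lt_iff₀ ht]
  refine h3.trans_lt ?_
  rw [mul_comm (t : ℝ) r]
  gcongr
  simp only
  linarith

/-- The generator of `S` extends `A` and is itself dissipative for the form, while `μ - A` is
already onto. Hence the extension cannot be proper. -/
theorem IsYosidaSeq.isGenerator {μ : ℝ} (hμ : 0 < μ) {R : H →L[ℝ] H} (hR : IsResolvent A μ R) :
    PIE.IsGenerator A S := by
  intro x y
  constructor
  · rintro ⟨hx, rfl⟩
    exact hB.tendsto_generator hP hS ⟨x, hx⟩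
  · intro h
    -- With `μ x' - A x' = μ x - y`, the difference `x - x'` has right derivative `y - A x' = μ (x -
    -- x')` under `S` at `0`. Dissipativity forces `μ [x - x', x - x'] ≤ 0`.
    obtain ⟨x', -, e⟩ := hR.exists_eq (μ • x - y)
    have h1 := h.sub (hB.tendsto_generator hP hS x')
    have e1 : y - A x' = μ • (x - x') := by
      have : A x' = μ • (x' : H) - (μ • x - y) := by rw [← e]; abel
      rw [this, smul_sub]; abel
    rw [e1] at h1
    have h2 : ⟪P (μ • (x - x')), x - x'⟫_ℝ ≤ 0 := by
      refine le_of_tendsto (((P.continuous.tendsto _).comp h1).inner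
        (tendsto_const_nhds (x := x - (x' : H)))) ?_
      filter_upwards [self_mem_nhdsWithin] with t ht
      have e2 : (t : ℝ)⁻¹ • (S t x - x) - (t : ℝ)⁻¹ • (S t x' - x')
          = (t : ℝ)⁻¹ • (S t (x - x') - (x - x')) := by
        rw [← smul_sub, map_sub]; congr 1; abel
      rw [Function.comp_apply, e2]
      set z := x - (x' : H)
      rw [map_smul, inner_smul_left, RCLike.conj_to_real]
      refine mul_nonpos_of_nonneg_of_nonpos (inv_nonneg.2 t.2) ?_
      -- From `0 ≤ [S z - z, S z - z]` and `[S z, S z] ≤ [z, z]` follows `[S z, z] ≤ [z, z]`, so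
      -- difference quotients are dissipative.
      have h3 := hP.nonneg (S t z - z)
      have h4 := hB.form_le hP hS t z
      have h5 := hP.symm z (S t z)
      simp only [map_sub, inner_sub_left, inner_sub_right] at h3 ⊢
      linarith
    rw [map_smul, inner_smul_left, RCLike.conj_to_real] at h2
    have h3 : x - x' = 0 := hP.eq_zero_of_form_nonpos (nonpos_of_mul_nonpos_right h2 hμ)
    have h4 : x = x' := sub_eq_zero.1 h3
    refine ⟨h4 ▸ x'.2, ?_⟩
    have h5 : (⟨x, h4 ▸ x'.2⟩ : D) = x' := Subtype.ext h4
    rw [h5, eq_comm, ← sub_eq_zero, e1, h3, smul_zero]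

end

end Limit

/-! ### Exponential rescaling and the Lumer–Phillips theorem -/

section Shift

theorem IsC0Semigroup.rescale {S : ℝ≥0 → H →L[ℝ] H} (hS : PIE.IsC0Semigroup S) (w : ℝ) :
    PIE.IsC0Semigroup fun t => Real.exp (w * t) • S t where
  zero := by simp [hS.zero]
  add t s := by
    rw [hS.add, NNReal.coe_add, mul_add, Real.exp_add, smul_mul_smul_comm]
  tendsto_zero x := by
    have h0 : Tendsto (fun t : ℝ≥0 => Real.exp (w * t)) (𝓝[>] 0) (𝓝 1) := by
      have : Continuous fun t : ℝ≥0 => Real.exp (w * t) := by fun_prop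
      exact (this.tendsto' 0 1 (by simp)).mono_left nhdsWithin_le_nhds
    simpa using h0.smul (hS.tendsto_zero x)

/-- Product rule at `0`: the quotient splits into `e^{wt} · t⁻¹ (S t x - x)` and `t⁻¹ (e^{wt} - 1)
x`. -/
theorem tendsto_rescale {S : ℝ≥0 → H →L[ℝ] H} (w : ℝ) {x y : H}
    (h : Tendsto (fun t : ℝ≥0 => (t : ℝ)⁻¹ • (S t x - x)) (𝓝[>] 0) (𝓝 y)) :
    Tendsto (fun t : ℝ≥0 => (t : ℝ)⁻¹ • ((Real.exp (w * t) • S t) x - x)) (𝓝[>] 0)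
      (𝓝 (y + w • x)) := by
  have h0 : Tendsto (fun t : ℝ≥0 => Real.exp (w * t)) (𝓝[>] 0) (𝓝 1) := by
    have : Continuous fun t : ℝ≥0 => Real.exp (w * t) := by fun_prop
    exact (this.tendsto' 0 1 (by simp)).mono_left nhdsWithin_le_nhds
  have h1 : Tendsto (fun t : ℝ≥0 => (t : ℝ)⁻¹ * (Real.exp (w * t) - 1)) (𝓝[>] 0) (𝓝 w) := by
    have hd : HasDerivAt (fun t : ℝ => Real.exp (w * t)) w 0 := by
      have := ((hasDerivAt_id (0 : ℝ)).const_mul w).exp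
      simpa using this
    have h2 := hd.tendsto_slope_zero_right
    have h3 : Tendsto (fun t : ℝ≥0 => (t : ℝ)) (𝓝[>] 0) (𝓝[>] 0) :=
      tendsto_nhdsWithin_iff.2
        ⟨(NNReal.continuous_coe.tendsto' 0 0 rfl).mono_left nhdsWithin_le_nhds, by
          filter_upwards [self_mem_nhdsWithin] with t ht
          exact NNReal.coe_pos.2 ht⟩
    refine (h2.comp h3).congr fun t => ?_
    simp
  have h2 := (h0.smul h).add (h1.smul_const x)
  rw [one_smul] at h2
  refine h2.congr fun t => ?_
  rw [smul_apply, mul_smul, smul_comm (Real.exp _), ← smul_add]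
  congr 1
  rw [smul_sub, sub_smul, one_smul]
  abel

theorem IsGenerator.rescale {S : ℝ≥0 → H →L[ℝ] H} (w : ℝ)
    {D : Submodule ℝ H} {A : D →ₗ[ℝ] H} (hA : PIE.IsGenerator (A - w • D.subtype) S) :
    PIE.IsGenerator A fun t => Real.exp (w * t) • S t := by
  intro x y
  have e : (∃ hx : x ∈ D, A ⟨x, hx⟩ = y)
      ↔ ∃ hx : x ∈ D, (A - w • D.subtype) ⟨x, hx⟩ = y - w • x := by
    refine exists_congr fun hx => ?_
    change _ ↔ A ⟨x, hx⟩ - w • x = y - w • x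
    exact sub_left_inj.symm
  rw [e, hA x (y - w • x)]
  constructor
  · intro h
    simpa using tendsto_rescale w h
  · intro h
    -- Rescaling by `-w` recovers `S`, so the converse needs no separate computation.
    have h1 := tendsto_rescale (-w) h
    rw [neg_smul, ← sub_eq_add_neg] at h1
    refine h1.congr fun t => ?_
    rw [smul_smul, ← Real.exp_add]
    simp

end Shift

/-- **Lumer-Phillips theorem** for an equivalent inner product `⟪P x, y⟫`. -/
theorem exists_semigroup [CompleteSpace H] {P : H →L[ℝ] H} {ε : ℝ} (hP : IsEquivForm P ε)
    {D : Submodule ℝ H} (A : D →ₗ[ℝ] H) {w μ : ℝ} (hμ : w < μ)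
    (hA : ∀ x : D, ⟪P (A x), x⟫_ℝ ≤ w * ⟪P (x : H), x⟫_ℝ)
    (hs : ∀ y, ∃ x : D, μ • (x : H) - A x = y) :
    ∃ S : ℝ≥0 → H →L[ℝ] H, PIE.IsC0Semigroup S ∧ PIE.IsGenerator A S ∧
      ∀ t, ‖S t‖ ≤ gain P ε * Real.exp (w * t) := by
  have hA' : IsDissipative P (A - w • D.subtype) := by
    intro x
    change ⟪P (A x - w • (x : H)), x⟫_ℝ ≤ 0
    rw [map_sub, map_smul, inner_sub_left, inner_smul_left, RCLike.conj_to_real]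
    linarith [hA x]
  have hμ' : 0 < μ - w := sub_pos.2 hμ
  obtain ⟨R, hR⟩ := exists_isResolvent hP hA' hμ' fun y => by
    obtain ⟨x, hx⟩ := hs y
    refine ⟨x, ?_⟩
    change (μ - w) • (x : H) - (A x - w • (x : H)) = y
    rw [← hx, sub_smul]
    abel
  obtain ⟨B, hB⟩ := exists_isYosidaSeq hP hA' hμ' hR
  obtain ⟨S, hS⟩ := hB.exists_limit hP
  have hC := hB.isC0Semigroup hP hS
  refine ⟨fun t => Real.exp (w * t) • S t, IsC0Semigroup.rescale hC w,
    IsGenerator.rescale w (hB.isGenerator hP hS hμ' hR), fun t => ?_⟩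
  rw [norm_smul, Real.norm_of_nonneg (Real.exp_pos _).le, mul_comm]
  have := ContinuousLinearMap.opNorm_le_bound _ hP.gain_nonneg (hB.norm_le hP hS t)
  gcongr

end LumerPhillips

/-! ### The du Bois-Reymond lemma and antiderivatives -/

namespace PIE

open scoped InnerProductSpace

/-- Test functions with vanishing integral have an antiderivative that is a test function. -/
theorem exists_primitive_test {a b : ℝ} (hab : a < b) {ψ : ℝ → ℝ} (hψ : ContDiff ℝ ∞ ψ)
    (hc : HasCompactSupport ψ) (hs : tsupport ψ ⊆ Set.Ioo a b) (h0 : ∫ s in a..b, ψ s = 0) :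
    ∃ φ : ℝ → ℝ, ContDiff ℝ ∞ φ ∧ HasCompactSupport φ ∧ tsupport φ ⊆ Set.Ioo a b ∧
      deriv φ = ψ := by
  -- The support is trapped in a compact interval inside `(a, b)`. The primitive from `a` vanishes
  -- left of `a'` because `ψ` does, and right of `b'` because the total integral is zero.
  obtain ⟨a', b', ha, hb, hab'⟩ : ∃ a' b', a < a' ∧ b' < b ∧ tsupport ψ ⊆ Set.Icc a' b' := by
    rcases (tsupport ψ).eq_empty_or_nonempty with he | hne
    · obtain ⟨m, h1, h2⟩ := exists_between hab
      exact ⟨m, m, h1, h2, by simp [he]⟩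
    · obtain ⟨x, hx⟩ := hc.isCompact.exists_isLeast hne
      obtain ⟨y, hy⟩ := hc.isCompact.exists_isGreatest hne
      exact ⟨x, y, (hs hx.1).1, (hs hy.1).2, fun z hz => ⟨hx.2 hz, hy.2 hz⟩⟩
  have hz : ∀ s, s ∉ Set.Icc a' b' → ψ s = 0 := fun s h =>
    image_eq_zero_of_notMem_tsupport fun h' => h (hab' h')
  have hint : ∀ x y, IntervalIntegrable ψ volume x y := fun x y =>
    hψ.continuous.intervalIntegrable x y
  have hd : ∀ s, HasDerivAt (fun s => ∫ θ in a..s, ψ θ) (ψ s) s := fun s =>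
    intervalIntegral.integral_hasDerivAt_right (hint a s)
      hψ.continuous.stronglyMeasurable.stronglyMeasurableAtFilter hψ.continuous.continuousAt
  have hderiv : deriv (fun s => ∫ θ in a..s, ψ θ) = ψ := funext fun s => (hd s).deriv
  have hsupp : Function.support (fun s => ∫ θ in a..s, ψ θ) ⊆ Set.Icc a' b' := by
    intro s hs'
    by_contra hns
    apply hs'
    rw [Set.mem_Icc, not_and_or, not_le, not_le] at hns
    rcases hns with h | h
    · refine (intervalIntegral.integral_congr (g := fun _ => 0) fun θ hθ => hz θ fun h' => ?_).trans
        intervalIntegral.integral_zero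
      rcases Set.mem_uIcc.1 hθ with h1 | h1 <;> linarith [h'.1, h1.1, h1.2]
    · change ∫ θ in a..s, ψ θ = 0
      rw [← intervalIntegral.integral_add_adjacent_intervals (hint a b) (hint b s), h0, zero_add]
      refine (intervalIntegral.integral_congr (g := fun _ => 0) fun θ hθ => hz θ fun h' => ?_).trans
        intervalIntegral.integral_zero
      rcases Set.mem_uIcc.1 hθ with h1 | h1 <;> linarith [h'.2, h1.1, h1.2]
  have hts : tsupport (fun s => ∫ θ in a..s, ψ θ) ⊆ Set.Icc a' b' :=
    closure_minimal hsupp isClosed_Icc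
  refine ⟨fun s => ∫ θ in a..s, ψ θ,
    contDiff_infty_iff_deriv.2 ⟨fun s => (hd s).differentiableAt, by rwa [hderiv]⟩,
    HasCompactSupport.of_support_subset_isCompact isCompact_Icc hsupp,
    fun s h => ⟨ha.trans_le (hts h).1, (hts h).2.trans_lt hb⟩, hderiv⟩

/-- **du Bois-Reymond lemma**. -/
theorem ae_eq_const_of_integral_deriv_eq_zero {a b : ℝ} (hab : a < b) {f : ℝ → ℝ}
    (hf : IntervalIntegrable f volume a b)
    (h : ∀ φ : ℝ → ℝ, ContDiff ℝ ∞ φ → HasCompactSupport φ → tsupport φ ⊆ Set.Ioo a b →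
      ∫ s in a..b, deriv φ s * f s = 0) :
    ∃ c, ∀ᵐ s ∂(volume.restrict (Set.Ioo a b)), f s = c := by
  -- A normalised bump at the midpoint; radius `(b - a) / 4` keeps its support inside `(a, b)`. The
  -- constant will be the `η`-weighted mean of `f`.
  let η₀ : ContDiffBump ((a + b) / 2) := ⟨(b - a) / 8, (b - a) / 4, by linarith, by linarith⟩
  set η : ℝ → ℝ := η₀.normed volume with hη
  have hηd : ContDiff ℝ ∞ η := η₀.contDiff_normed
  have hηs : tsupport η ⊆ Set.Ioo a b := by
    rw [hη, η₀.tsupport_normed_eq, Real.closedBall_eq_Icc]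
    intro x hx
    have h1 : η₀.rOut = (b - a) / 4 := rfl
    rw [h1] at hx
    exact ⟨by linarith [hx.1], by linarith [hx.2]⟩
  have hηi : ∫ s in a..b, η s = 1 := by
    rw [intervalIntegral.integral_of_le hab.le, ← η₀.integral_normed (μ := volume)]
    refine setIntegral_eq_integral_of_forall_compl_eq_zero fun x hx => ?_
    refine image_eq_zero_of_notMem_tsupport fun h' => hx ?_
    exact ⟨(hηs h').1, (hηs h').2.le⟩
  set c := ∫ s in a..b, η s * f s with hc
  refine ⟨c, ?_⟩
  have hmul : ∀ g : ℝ → ℝ, Continuous g → IntervalIntegrable (fun s => g s * f s) volume a b :=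
    fun g hg => hf.continuousOn_mul hg.continuousOn
  have hfc : IntervalIntegrable (fun s => f s - c) volume a b := hf.sub intervalIntegrable_const
  have hloc : LocallyIntegrableOn (fun s => f s - c) (Set.Ioo a b) volume :=
    (((intervalIntegrable_iff_integrableOn_Ioo_of_le hab.le).1 hfc)).locallyIntegrableOn
  have key := isOpen_Ioo.ae_eq_zero_of_integral_contDiff_smul_eq_zero (U := Set.Ioo a b)
    hloc fun g hg hgc hgs => ?_
  · rw [ae_restrict_iff' measurableSet_Ioo]
    filter_upwards [key] with s hs hs'
    exact sub_eq_zero.1 (hs hs')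
  · have e1 : ∫ s, g s • (f s - c) = ∫ s in a..b, g s * (f s - c) := by
      rw [intervalIntegral.integral_of_le hab.le]
      refine (setIntegral_eq_integral_of_forall_compl_eq_zero fun x hx => ?_).symm
      have : g x = 0 := image_eq_zero_of_notMem_tsupport fun h' =>
        hx ⟨(hgs h').1, (hgs h').2.le⟩
      rw [this, zero_smul]
    set m := ∫ s in a..b, g s with hm
    have hgi := hg.continuous.intervalIntegrable (μ := volume) a b
    have hηint := hηd.continuous.intervalIntegrable (μ := volume) a b
    have h0 : ∫ s in a..b, (g - m • η) s = 0 := by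
      have : ∫ s in a..b, (g - m • η) s = (∫ s in a..b, g s) - ∫ s in a..b, m * η s :=
        intervalIntegral.integral_sub hgi (hηint.const_mul m)
      rw [this, intervalIntegral.integral_const_mul, hηi, mul_one, sub_self]
    have hηc : HasCompactSupport (m • η) := by
      refine HasCompactSupport.of_support_subset_isCompact (isCompact_Icc (a := a) (b := b)) ?_
      exact (Function.support_const_smul_subset m η).trans
        ((subset_tsupport η).trans (hηs.trans Set.Ioo_subset_Icc_self))
    -- Subtracting `(∫ g) η` from a test function `g` leaves mean zero, hence a derivative `φ'`.
    -- Testing `f` against it gives `∫ g (f - c) = 0`.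
    obtain ⟨φ, h1, h2, h3, h4⟩ := exists_primitive_test hab (ψ := g - m • η)
      (hg.sub (hηd.const_smul m)) (hgc.sub hηc)
      (by
        refine (tsupport_sub g (m • η)).trans (Set.union_subset hgs ?_)
        exact (closure_mono (Function.support_const_smul_subset m η)).trans hηs) h0
    have h5 := h φ h1 h2 h3
    rw [h4] at h5
    have e2 : ∫ s in a..b, (g - m • η) s * f s
        = (∫ s in a..b, g s * f s) - m * c := by
      rw [hc, ← intervalIntegral.integral_const_mul, ← intervalIntegral.integral_sub
        (hmul g hg.continuous) ((hmul η hηd.continuous).const_mul m)]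
      refine intervalIntegral.integral_congr fun s _ => ?_
      simp only [Pi.sub_apply, Pi.smul_apply, smul_eq_mul]
      ring
    have e3 : ∫ s in a..b, g s * (f s - c) = (∫ s in a..b, g s * f s) - m * c := by
      rw [hm, ← intervalIntegral.integral_mul_const, ← intervalIntegral.integral_sub
        (hmul g hg.continuous) (hgi.mul_const c)]
      exact intervalIntegral.integral_congr fun s _ => mul_sub _ _ _
    rw [e1, e3, ← e2, h5]

/-- A continuous function with integrable weak derivative `h` is an antiderivative of `h`. -/
theorem eq_add_integral_of_weakDeriv {a b : ℝ} (hab : a < b) {f h : ℝ → ℝ}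
    (hf : ContinuousOn f (Set.Icc a b)) (hh : IntervalIntegrable h volume a b)
    (H : ∀ φ : ℝ → ℝ, ContDiff ℝ ∞ φ → HasCompactSupport φ → tsupport φ ⊆ Set.Ioo a b →
      ∫ s in a..b, deriv φ s * f s = -∫ s in a..b, φ s * h s) :
    ∀ s ∈ Set.Icc a b, f s = f a + ∫ θ in a..s, h θ := by
  -- For `d = 1` and zero initial value, `chain` is `s ↦ ∫_a^s h`, and `chain_test` says that its
  -- weak derivative is `h`.
  obtain ⟨hGc, -, hG⟩ := chain_step hab.le (fun _ : Fin 1 => 0) hh Nat.zero_lt_one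
  have e1 : chain 1 a (fun _ : Fin 1 => 0) h (0 + 1) = h := by funext s; simp [chain]
  rw [e1] at hG
  set G := chain 1 a (fun _ : Fin 1 => 0) h 0 with hGdef
  have hint : ∀ g : ℝ → ℝ, ContinuousOn g (Set.Icc a b) → IntervalIntegrable g volume a b :=
    fun g hg => ContinuousOn.intervalIntegrable (by rwa [Set.uIcc_of_le hab.le])
  obtain ⟨c, hc⟩ := ae_eq_const_of_integral_deriv_eq_zero hab (f := fun s => f s - G s)
    (hint _ (hf.sub hGc)) fun φ h1 h2 h3 => by
      have h4 := chain_test hab.le (fun _ : Fin 1 => 0) hh (le_refl 1) h1 h3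
      have e2 : chain 1 a (fun _ : Fin 1 => 0) h 1 = h := e1
      rw [e2, iteratedDeriv_one, pow_one, neg_one_mul, ← hGdef] at h4
      have hφ : Continuous (deriv φ) := (contDiff_infty_iff_deriv.1 h1).2.continuous
      simp only [mul_sub]
      rw [intervalIntegral.integral_sub (f := fun s => deriv φ s * f s)
        (g := fun s => deriv φ s * G s) (hint _ (hφ.continuousOn.mul hf))
        (hint _ (hφ.continuousOn.mul hGc)), H φ h1 h2 h3, h4, sub_self]
  -- The difference is constant almost everywhere, and by continuity on all of `[a, b]`, including
  -- the endpoint `a`.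
  have heq : Set.EqOn (fun s => f s - G s) (fun _ => c) (Set.Icc a b) := by
    refine Measure.eqOn_Icc_of_ae_eq volume hab.ne ?_ (hf.sub hGc) continuousOn_const
    rwa [← restrict_Ioo_eq_restrict_Icc]
  intro s hs
  have h1 := heq hs
  have h2 := heq (Set.left_mem_Icc.2 hab.le)
  have h3 := hG s hs
  simp only at h1 h2
  linarith

/-! ### Taylor polynomials on the kernel of `∂_s^d`, and `𝒯` as a bijection onto `D` -/

/-- Each weak derivative is defined directly from `u`. Testing order `j` with `φ'` and order `j + 1`
with `φ` produces the same integral against `u`, which links consecutive orders. -/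
theorem hasWeakDeriv_one_weakDeriv {n d : ℕ} {a b : ℝ} (u : sobolev n d a b) (j : Fin d) :
    HasWeakDeriv a b 1 (weakDeriv j.castSucc u) (weakDeriv j.succ u) := by
  intro φ h1 h2 h3
  have h4 : ∫ s in Set.Icc a b, iteratedDeriv j.val (deriv φ) s • (u : L2 n a b) s
      = (-1 : ℝ) ^ j.val • ∫ s in Set.Icc a b, deriv φ s • weakDeriv j.castSucc u s :=
    weakDeriv_spec j.castSucc u (deriv φ) (contDiff_infty_iff_deriv.1 h1).2 h2.deriv
      (tsupport_deriv_subset.trans h3)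
  have h5 : ∫ s in Set.Icc a b, iteratedDeriv (j.val + 1) φ s • (u : L2 n a b) s
      = (-1 : ℝ) ^ (j.val + 1) • ∫ s in Set.Icc a b, φ s • weakDeriv j.succ u s :=
    weakDeriv_spec j.succ u φ h1 h2 h3
  rw [iteratedDeriv_succ'] at h5
  rw [h5, pow_succ, mul_smul] at h4
  rw [iteratedDeriv_one, pow_one]
  exact (smul_right_injective _ (pow_ne_zero _ (by norm_num : (-1 : ℝ) ≠ 0)) h4).symm

theorem HasWeakDeriv.coord {n k : ℕ} {a b : ℝ} (hab : a ≤ b) {u w : L2 n a b}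
    (h : HasWeakDeriv a b k u w) (p : Fin n) {φ : ℝ → ℝ} (h1 : ContDiff ℝ ∞ φ)
    (h2 : HasCompactSupport φ) (h3 : tsupport φ ⊆ Set.Ioo a b) :
    ∫ s in a..b, iteratedDeriv k φ s * u s p = (-1) ^ k * ∫ s in a..b, φ s * w s p := by
  have e : ∀ (ψ : ℝ → ℝ), Continuous ψ → ∀ v : L2 n a b,
      (∫ s in Set.Icc a b, ψ s • v s) p = ∫ s in a..b, ψ s * v s p := by
    intro ψ hψ v
    rw [intervalIntegral.integral_of_le hab, ← integral_Icc_eq_integral_Ioc]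
    exact ((EuclideanSpace.proj (𝕜 := ℝ) p).integral_comp_comm (L2.integrable_smul v hψ)).symm
  have h4 := congrArg (fun x : Vec n => x p) (h φ h1 h2 h3)
  simp only [PiLp.smul_apply, smul_eq_mul] at h4
  rwa [e _ (continuous_iteratedDeriv_test h1 k), e _ h1.continuous] at h4

theorem intervalIntegral_congr_restrict_Icc {a b : ℝ} (hab : a ≤ b) {f g : ℝ → ℝ}
    (h : f =ᵐ[volume.restrict (Set.Icc a b)] g) : ∫ s in a..b, f s = ∫ s in a..b, g s := by
  rw [intervalIntegral.integral_of_le hab, intervalIntegral.integral_of_le hab,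
    ← integral_Icc_eq_integral_Ioc, ← integral_Icc_eq_integral_Ioc]
  exact integral_congr_ae h

theorem chain_left {d : ℕ} (a : ℝ) (c : Fin d → ℝ) (v : ℝ → ℝ) (j : Fin d) :
    chain d a c v j a = c j := by
  rw [chain, if_pos j.2, Finset.sum_eq_single j]
  · simp [iterInt]
  · intro l _ hl
    by_cases h : j.val ≤ l.val
    · have : l.val - j.val ≠ 0 := by
        have : l.val ≠ j.val := fun h => hl (Fin.ext h)
        omega
      simp [h, this]
    · simp [h]
  · simp

/-- Taylor expansion from `a` to `b` is multiplication of the initial data by `Q(b - a)`; this is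
how `K = B + C Q(b - a)` enters. -/
theorem chain_zero_eq_mulVec {n d : ℕ} (a b : ℝ) (y : Fin d × Fin n → ℝ) (j : Fin d) (q : Fin n) :
    chain d a (fun l => y (l, q)) (fun _ => 0) j b = (matQ n d (b - a)).mulVec y (j, q) := by
  rw [chain, if_pos j.2, Matrix.mulVec, dotProduct, Fintype.sum_prod_type]
  have e : iterInt a (d - 1 - j) (fun _ => 0) b = 0 := by simp [iterInt]
  rw [e, add_zero]
  refine Finset.sum_congr rfl fun l _ => ?_
  rw [Finset.sum_eq_single q]
  · simp [matQ]
  · intro p _ hp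
    simp [matQ, hp.symm]
  · simp

/-- The continuous representatives of the derivatives of a function with `∂_s^d u = 0` are the
Taylor polynomials at `a`. -/
theorem eq_chain_of_weakDeriv_last_eq_zero {n d : ℕ} {a b : ℝ} (hab : a < b) (u : sobolev n d a b)
    (h0 : weakDeriv (Fin.last d) u = 0) {f : Fin d → ℝ → Vec n}
    (hf : ∀ j, ContinuousOn (f j) (Set.Icc a b) ∧
      weakDeriv j.castSucc u =ᵐ[volume.restrict (Set.Icc a b)] f j) (p : Fin n) (j : Fin d) :
    ∀ s ∈ Set.Icc a b, f j s p = chain d a (fun l => f l a p) (fun _ => 0) j s := by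
  set c : Fin d → ℝ := fun l => f l a p with hc
  have hv : IntervalIntegrable (fun _ : ℝ => (0 : ℝ)) volume a b := intervalIntegrable_const
  -- Integration from order `j + 1` to order `j`: both sides are antiderivatives of the same
  -- function and have the value `c j` at `a`.
  have step : ∀ j : Fin d, ((fun s => weakDeriv j.succ u s p)
      =ᵐ[volume.restrict (Set.Icc a b)] chain d a c (fun _ => 0) (j.val + 1)) →
      ∀ s ∈ Set.Icc a b, f j s p = chain d a c (fun _ => 0) j s := by
    intro j hj s hs
    obtain ⟨-, h1, h2⟩ := chain_step hab.le c hv j.2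
    have hfc : ContinuousOn (fun s => f j s p) (Set.Icc a b) :=
      (EuclideanSpace.proj (𝕜 := ℝ) p).continuous.comp_continuousOn (hf j).1
    have h3 := eq_add_integral_of_weakDeriv hab hfc h1 fun φ g1 g2 g3 => by
      have h4 := (hasWeakDeriv_one_weakDeriv u j).coord hab.le p g1 g2 g3
      rw [iteratedDeriv_one, pow_one, neg_one_mul] at h4
      rw [intervalIntegral_congr_restrict_Icc hab.le (g := fun s =>
          deriv φ s * weakDeriv j.castSucc u s p), h4,
        intervalIntegral_congr_restrict_Icc hab.le (g := fun s =>
          φ s * chain d a c (fun _ => 0) (j.val + 1) s)]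
      · filter_upwards [hj] with s hs
        rw [hs]
      · filter_upwards [(hf j).2] with s hs
        rw [hs]
    rw [h3 s hs, h2 s hs, chain_left]
  -- Descending induction on the order `i = d - m`, from the top derivative, which vanishes.
  have main : ∀ m, m ≤ d → ∀ i (hi : i ≤ d), i + m = d →
      (fun s => weakDeriv ⟨i, Nat.lt_succ_of_le hi⟩ u s p)
        =ᵐ[volume.restrict (Set.Icc a b)] chain d a c (fun _ => 0) i := by
    intro m
    induction m with
    | zero =>
      intro _ i hi hid
      have hid' : i = d := hid
      subst hid'
      have e : weakDeriv ⟨i, Nat.lt_succ_of_le hi⟩ u = 0 := h0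
      rw [e]
      filter_upwards [Lp.coeFn_zero (Vec n) 2 (volume.restrict (Set.Icc a b))] with s hs
      rw [hs]
      simp [chain]
    | succ m ih =>
      intro hm i hi him
      have h1 := step ⟨i, by omega⟩ (ih (by omega) (i + 1) (by omega) (by omega))
      filter_upwards [(hf ⟨i, by omega⟩).2, ae_restrict_mem measurableSet_Icc] with s hs hs'
      rw [← h1 s hs', ← hs]
      rfl
  exact step j (main (d - 1 - j) (by omega) (j + 1) (by omega) (by omega))

theorem weakDeriv_zero_eq {n d : ℕ} {a b : ℝ} (u : sobolev n d a b) : weakDeriv 0 u = u :=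
  (weakDeriv_spec 0 u).unique fun φ _ _ _ => by simp

/-- `∂_s^d` is injective on `D`. -/
theorem eq_zero_of_weakDeriv_last_eq_zero {n d : ℕ} {a b : ℝ} (hab : a < b) (hd : 0 < d)
    {B C : Matrix (Fin d × Fin n) (Fin d × Fin n) ℝ} (hK : PIECompatible a b B C)
    (x : pieDomain a b B C)
    (h0 : weakDeriv (Fin.last d) (Submodule.inclusion (pieDomain_le_sobolev B C) x) = 0) :
    x = 0 := by
  obtain ⟨u, hu, f, hf, hB⟩ := x
  have hchain := eq_chain_of_weakDeriv_last_eq_zero hab ⟨u, hu⟩ h0 hf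
  set y : Fin d × Fin n → ℝ := fun x => f x.1 a x.2 with hy
  have hsum : ∀ (M : Matrix (Fin d × Fin n) (Fin d × Fin n) ℝ) (y : Fin d × Fin n → ℝ) i (p : Fin n),
      ∑ j, ∑ q, M (i, p) (j, q) * y (j, q) = M.mulVec y (i, p) := by
    intro M y i p
    rw [Matrix.mulVec, dotProduct, Fintype.sum_prod_type]
  have hb : ∀ (j : Fin d) (q : Fin n), f j b q = (matQ n d (b - a)).mulVec y (j, q) := fun j q =>
    (hchain q j b (Set.right_mem_Icc.2 hab.le)).trans (chain_zero_eq_mulVec a b y j q)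
  -- The values at `b` are `Q(b - a) y`, so the boundary conditions read `B y + C Q(b - a) y = 0`.
  have hKy : (matK a b B C).mulVec y = 0 := by
    funext ⟨i, p⟩
    have h1 := congrArg (fun x : Vec n => x p) (hB i)
    have e : (∑ j, (matCLM (block B i j) (f j a) + matCLM (block C i j) (f j b))) p
        = ∑ j, ((∑ q, B (i, p) (j, q) * f j a q) + ∑ q, C (i, p) (j, q) * f j b q) := by
      rw [WithLp.ofLp_sum, Finset.sum_apply]
      rfl
    simp only at h1
    rw [e, Finset.sum_add_distrib] at h1
    simp only [hb] at h1
    rw [hsum C ((matQ n d (b - a)).mulVec y) i p] at h1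
    have h2 := hsum B y i p
    rw [h2, Matrix.mulVec_mulVec] at h1
    rw [matK, Matrix.add_mulVec]
    exact h1
  have hy0 : y = 0 := by
    have h1 := congrArg (matK a b B C)⁻¹.mulVec hKy
    rwa [Matrix.mulVec_mulVec, Matrix.nonsing_inv_mul _ ((Matrix.isUnit_iff_isUnit_det _).1 hK),
      Matrix.one_mulVec, Matrix.mulVec_zero] at h1
  apply Subtype.ext
  apply Lp.ext
  -- The order-zero representative, which exists since `d ≥ 1`, represents `u` itself and is a
  -- polynomial with vanishing coefficients.
  have h1 : weakDeriv (0 : Fin (d + 1)) ⟨u, hu⟩ = u := weakDeriv_zero_eq ⟨u, hu⟩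
  have h2 := (hf ⟨0, hd⟩).2
  have h3 : weakDeriv (Fin.castSucc ⟨0, hd⟩) ⟨u, hu⟩ = u := h1
  rw [h3] at h2
  refine h2.trans (EventuallyEq.trans ?_ (Lp.coeFn_zero _ _ _).symm)
  filter_upwards [ae_restrict_mem measurableSet_Icc] with s hs
  ext p
  rw [hchain p ⟨0, hd⟩ s hs]
  have h4 : ∀ l : Fin d, f l a p = 0 := fun l => congrFun hy0 (l, p)
  simp [chain, iterInt, h4]

/-- `𝒯 ∂_s^d u = u` on `D`. -/
theorem exists_eq_greenOp {n d : ℕ} {a b : ℝ} (hab : a < b) (hd : 0 < d)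
    {B C : Matrix (Fin d × Fin n) (Fin d × Fin n) ℝ} (hK : PIECompatible a b B C)
    (x : pieDomain a b B C) : ∃ v, x = ⟨greenOp B C v, greenOp_mem hab.le hd hK v⟩ := by
  let L : pieDomain a b B C →ₗ[ℝ] L2 n a b :=
    weakDeriv (Fin.last d) ∘ₗ Submodule.inclusion (pieDomain_le_sobolev B C)
  -- Take `v = ∂_s^d x`. Then `x - 𝒯 v` lies in `D` and is annihilated by `∂_s^d`, because `∂_s^d 𝒯
  -- v = v`.
  refine ⟨L x, sub_eq_zero.1 (eq_zero_of_weakDeriv_last_eq_zero hab hd hK _ ?_)⟩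
  change L (x - _) = 0
  rw [map_sub, sub_eq_zero]
  exact (weakDeriv_last_greenOp hab.le hd B C (L x)).symm

/-- Needed for gain at least `1`, which fails on the zero space; a nonzero constant function is the
witness. -/
theorem nontrivial_L2 {n : ℕ} (hn : 0 < n) {a b : ℝ} (hab : a < b) : Nontrivial (L2 n a b) := by
  have hμ : (volume.restrict (Set.Icc a b)) Set.univ ≠ 0 := by
    simp [hab]
  let e : Vec n := EuclideanSpace.single ⟨0, hn⟩ 1
  have he : e ≠ 0 := by
    intro h
    have := congrArg (fun x : Vec n => x ⟨0, hn⟩) h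
    simp [e] at this
  refine ⟨⟨indicatorConstLp 2 MeasurableSet.univ (measure_ne_top _ _) e, 0, fun h => ?_⟩⟩
  have h1 := congrArg norm h
  rw [norm_zero, norm_indicatorConstLp (by norm_num) (by norm_num), mul_eq_zero] at h1
  rcases h1 with h1 | h1
  · exact he (norm_eq_zero.1 h1)
  · have : 0 < (volume.restrict (Set.Icc a b)).real Set.univ :=
      ENNReal.toReal_pos hμ (measure_ne_top _ _)
    exact (Real.rpow_pos_of_pos this _).ne' h1

end PIE

/-! ### From the operator inequalities to the semigroup -/

open scoped InnerProductSpace in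
theorem mainTheorem3 (n d : ℕ) (hn : 0 < n) (hd : 0 < d) (a b : ℝ) (hab : a < b)
    (B C : Matrix (Fin d × Fin n) (Fin d × Fin n) ℝ) (hK : PIE.PIECompatible a b B C)
    (A : Fin (d + 1) → Matrix (Fin n) (Fin n) ℝ[X])
    (T : PIE.L2 n a b →L[ℝ] PIE.L2 n a b) (hT : T = PIE.greenOp B C)
    (cA : PIE.L2 n a b →L[ℝ] PIE.L2 n a b) (hcA : cA = PIE.pieOp hab.le hd hK A)
    (ε₁ ε₂ rate lam : ℝ) (hε₁ : 0 < ε₁) (hε₂ : 0 < ε₂) (hlam : rate < lam)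
    (P : PIE.L2 n a b →L[ℝ] PIE.L2 n a b) (hP : PIE.IsPIOperator P)
    (hPpos : ε₁ ^ 2 • (1 : PIE.L2 n a b →L[ℝ] PIE.L2 n a b) ≤ P)
    (hdiss : T.adjoint ∘L P ∘L cA + cA.adjoint ∘L P ∘L T ≤ (2 * rate) • (T.adjoint ∘L P ∘L T))
    (hsurj : ε₂ ^ 2 • (1 : PIE.L2 n a b →L[ℝ] PIE.L2 n a b) ≤
      (lam • T - cA) ∘L (lam • T.adjoint - cA.adjoint)) :
    ∃ S : NNReal → PIE.L2 n a b →L[ℝ] PIE.L2 n a b,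
      PIE.IsC0Semigroup S ∧ PIE.IsGenerator (PIE.diffOp a b B C A) S ∧
        PIE.HasGrowthRate S rate (Real.sqrt ‖P‖ / ε₁) := by
  have hsmul : ∀ (c : ℝ) (x y : PIE.L2 n a b), ⟪c • x, y⟫_ℝ = c * ⟪x, y⟫_ℝ := fun c x y => by
    rw [inner_smul_left, RCLike.conj_to_real]
  have hform : LumerPhillips.IsEquivForm P ε₁ := by
    rw [ContinuousLinearMap.le_def, ContinuousLinearMap.isPositive_iff] at hPpos
    refine ⟨hε₁, fun x y => ?_, fun x => ?_⟩
    · have h1 : ⟪P x - ε₁ ^ 2 • x, y⟫_ℝ = ⟪x, P y - ε₁ ^ 2 • y⟫_ℝ := hPpos.1 x y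
      rw [inner_sub_left, inner_sub_right, hsmul, inner_smul_right] at h1
      rw [real_inner_comm x (P y)]
      linarith
    · have h1 : 0 ≤ ⟪P x - ε₁ ^ 2 • x, x⟫_ℝ := hPpos.2 x
      rw [inner_sub_left, hsmul, real_inner_self_eq_norm_sq] at h1
      linarith
  have hop : ∀ v, PIE.diffOp a b B C A
      ⟨PIE.greenOp B C v, PIE.greenOp_mem hab.le hd hK v⟩ = cA v := fun v => by
    rw [hcA]; rfl
  have hA : ∀ x : PIE.pieDomain a b B C,
      ⟪P (PIE.diffOp a b B C A x), x⟫_ℝ ≤ rate * ⟪P (x : PIE.L2 n a b), x⟫_ℝ := by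
    intro x
    obtain ⟨v, rfl⟩ := PIE.exists_eq_greenOp hab hd hK x
    rw [hop]
    dsimp only
    rw [← hT]
    rw [ContinuousLinearMap.le_def, ContinuousLinearMap.isPositive_iff] at hdiss
    -- Moving the adjoints across and using symmetry of `P`, the second inequality at `v` says `2 ⟪P
    -- (cA v), T v⟫ ≤ 2 · rate · ⟪P (T v), T v⟫`, where `T v = x` and `cA v = A x`.
    have h1 : 0 ≤ ⟪(2 * rate) • T.adjoint (P (T v))
        - (T.adjoint (P (cA v)) + cA.adjoint (P (T v))), v⟫_ℝ := hdiss.2 v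
    rw [inner_sub_left, inner_add_left, hsmul, ContinuousLinearMap.adjoint_inner_left,
      ContinuousLinearMap.adjoint_inner_left, ContinuousLinearMap.adjoint_inner_left,
      hform.symm (T v) (cA v)] at h1
    linarith
  have hs : ∀ y, ∃ x : PIE.pieDomain a b B C,
      lam • (x : PIE.L2 n a b) - PIE.diffOp a b B C A x = y := by
    intro y
    rw [ContinuousLinearMap.le_def, ContinuousLinearMap.isPositive_iff] at hsurj
    -- For `L = lam • T - cA` the operator `L L*` is coercive with constant `ε₂²`, hence onto. As
    -- `(lam - A) T = L`, the preimage of `y` under `lam - A` is `T (L* x)`.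
    obtain ⟨x, hx⟩ := LumerPhillips.surjective_of_coercive
      ((lam • T - cA) ∘L (lam • T.adjoint - cA.adjoint)) (pow_pos hε₂ 2) (fun x => by
        have h1 : 0 ≤ ⟪((lam • T - cA) ∘L (lam • T.adjoint - cA.adjoint)) x - ε₂ ^ 2 • x, x⟫_ℝ :=
          hsurj.2 x
        rw [inner_sub_left, hsmul, real_inner_self_eq_norm_sq] at h1
        linarith) y
    refine ⟨⟨PIE.greenOp B C ((lam • T.adjoint - cA.adjoint) x), PIE.greenOp_mem hab.le hd hK _⟩, ?_⟩
    rw [hop]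
    dsimp only
    rw [← hT]
    exact hx
  obtain ⟨S, h1, h2, h3⟩ := LumerPhillips.exists_semigroup hform (PIE.diffOp a b B C A) hlam hA hs
  have := PIE.nontrivial_L2 hn hab
  exact ⟨S, h1, h2, hform.one_le_gain, h3⟩
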